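/- Let $\mathbb{K}\in\{\mathbb{R},\mathbb{C}\}$ and let $\ell,n,m\geq 1$ be integers. For $E,A\in\mathbb{K}^{\ell\times n}$ and $B\in\mathbb{K}^{\ell\times m}$ let the behaviour $\mathfrak{B}_{[E,A,B]}$ be the set of all $(x,u)\in L^1_{\mathrm{loc}}(\mathbb{R},\mathbb{K}^n)\times L^1_{\mathrm{loc}}(\mathbb{R},\mathbb{K}^m)$ such that $Ex$ is locally absolutely continuous and $\frac{\mathrm d}{\mathrm dt}(Ex)=Ax+Bu$ almost everywhere. The system $[E,A,B]$ is called - freely initializable if for every $x^0\in\mathbb{K}^n$ there is $(x,u)\in\mathfrak{B}_{[E,A,B]}$ with $x(0)=x^0$; - impulse controllable if for every $x^0\in\mathbb{K}^n$ there is $(x,u)\in\mathfrak{B}_{[E,A,B]}$ with $Ex(0)=Ex^0$; - behaviourally controllable if for all $(x_1,u_1),(x_2,u_2)\in\mathfrak{B}_{[E,A,B]}$ there are $T>0$ and $(x,u)\in\mathfrak{B}_{[E,A,B]}$ with $(x,u)(t)=(x_1,u_1)(t)$ for $t<0$ and $(x,u)(t)=(x_2,u_2)(t)$ for $t>T$;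 - completely controllable if there is $T>0$ such that for all $x^0,x_T\in\mathbb{K}^n$ there is $(x,u)\in\mathfrak{B}_{[E,A,B]}$ with $x(0)=x^0$ and $x(T)=x_T$; - strongly controllable if there is $T>0$ such that for all $x^0,x_T\in\mathbb{K}^n$ there is $(x,u)\in\mathfrak{B}_{[E,A,B]}$ with $Ex(0)=Ex^0$ and $Ex(T)=Ex_T$. Here a condition $x(t_0)=v$ on a locally integrable $x$ means that $x$ is continuous at $t_0$ with value $v$. Let $$\Sigma^{H}=\{(E,J,Q,B)\mid J=-J^*,\ E^*Q=Q^*E\geq 0\},$$ $$\Sigma^{sdH}=\{(E,J,R,Q,B)\mid J=-J^*,\ R=R^*\geq 0,\ E^*Q=Q^*E\geq 0\},$$ $$\Sigma^{dH}=\{(E,J,R,Q,B)\mid J=-J^*,\ R=R^*>0,\ E^*Q=Q^*E\geq 0\},$$ where $E,Q\in\mathbb{K}^{\ell\times n}$, $J,R\in\mathbb{K}^{\ell\times\ell}$ and $B\in\mathbb{K}^{\ell\times m}$. For each of the five concepts $c$ let $S_c^{H}$ be the set of $(E,J,Q,B)\in\Sigma^{H}$ such that $[E,JQ,B]$ has property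 $c$, and let $S_c^{sdH}$ and $S_c^{dH}$ be the sets of $(E,J,R,Q,B)$ in $\Sigma^{sdH}$ and $\Sigma^{dH}$, respectively, such that $[E,(J-R)Q,B]$ has property $c$. For subsets $S,V$ of a finite-dimensional real vector space, identified with $\mathbb{R}^N$ by a linear isomorphism (spaces of complex matrices are regarded as real vector spaces), $S$ is called relative generic in $V$ if there is a set $\mathbb{V}\subseteq\mathbb{R}^N$, the common zero set of finitely many real polynomials, such that $S^c\cap V\subseteq\mathbb{V}$ and $\mathbb{V}^c\cap V$ is dense in $V$ in the Euclidean topology. Then for each $*\in\{H,sdH,dH\}$: 1. $S^{*}_{\text{freely initializable}}$ is relative generic in $\Sigma^{*}$ if and only if $\ell\leq n+m$; 2. $S^{*}_{\text{impulse controllable}}$ is relative generic in $\Sigma^{*}$ if and only if $\ell\leq n+m$; 3. $S^{*}_{\text{behaviourally controllable}}$ is relative generic in $\Sigma^{*}$ if and only if $\ell\neq n+m$; 4. $S^{*}_{\text{completely controllable}}$ is relative generic in $\Sigma^{*}$ if and only if $\ell<n+m$; 5. $S^{*}_{\text{strongly controllable}}$ is relative generic in $\Sigma^{*}$ if and only if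 $\ell<n+m$. Moreover, for each of the five concepts $c$, if $S_c^{*}$ is not relative generic in $\Sigma^{*}$, then its complement $(S_c^{*})^c$ is relative generic in $\Sigma^{*}$. -/

import Mathlib

open scoped Matrix ComplexOrder

namespace PortHamiltonian

/-! ### Relative genericity -/

/-- Real algebraic sets: common zero sets of finitely many real polynomials in `N` variables. -/
def IsAlgebraicSet {N : ℕ} (W : Set (Fin N → ℝ)) : Prop :=
  ∃ (k : ℕ) (p : Fin k → MvPolynomial (Fin N) ℝ),
    W = {x | ∀ i, MvPolynomial.eval x (p i) = 0}

/-- `S` is relative generic in `V` (both subsets of `ℝ^N`): outside an algebraic set `W` every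
point of `V` lies in `S`, and `Wᶜ ∩ V` is dense in `V` for the Euclidean topology. -/
def RelGenericReal {N : ℕ} (S V : Set (Fin N → ℝ)) : Prop :=
  ∃ W : Set (Fin N → ℝ), IsAlgebraicSet W ∧ Sᶜ ∩ V ⊆ W ∩ V ∧ V ⊆ closure (Wᶜ ∩ V)

/-- Relative genericity in a finite-dimensional real vector space `X` (for instance a space of
tuples of real or complex matrices), through a real-linear isomorphism `X ≃ ℝ^N`. Linear changes
of coordinates preserve algebraic sets and density, so the choice of `φ` does not matter. -/
def RelGeneric {X : Type*} [AddCommGroup X] [Module ℝ X] (S V : Set X) : Prop :=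
  ∃ (N : ℕ) (φ : X ≃ₗ[ℝ] (Fin N → ℝ)), RelGenericReal (φ '' S) (φ '' V)

/-! ### Differential-algebraic systems `d/dt (E x) = A x + B u` -/

section DAE

variable {𝕜 : Type*} [RCLike 𝕜] {ℓ n m : ℕ}

/-- The behaviour of `d/dt (E x) = A x + B u`: locally integrable `x, u` on `ℝ` such that `E x` is
(locally) absolutely continuous and the equation holds almost everywhere. -/
def behaviour (E A : Matrix (Fin ℓ) (Fin n) 𝕜) (B : Matrix (Fin ℓ) (Fin m) 𝕜) :
    Set ((ℝ → Fin n → 𝕜) × (ℝ → Fin m → 𝕜)) :=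
  {w | MeasureTheory.LocallyIntegrable w.1 ∧ MeasureTheory.LocallyIntegrable w.2 ∧
    (∀ a b : ℝ, AbsolutelyContinuousOnInterval (fun t => E *ᵥ w.1 t) a b) ∧
    ∀ᵐ t : ℝ, HasDerivAt (fun s => E *ᵥ w.1 s) (A *ᵥ w.1 t + B *ᵥ w.2 t) t}

/-- `x(t) = v` for a locally integrable `x`. Point values of such a function can be altered at
will on a null set; the value at `t` is understood to be attained continuously. -/
def HasValueAt (x : ℝ → Fin n → 𝕜) (t : ℝ) (v : Fin n → 𝕜) : Prop :=
  ContinuousAt x t ∧ x t = v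

def FreelyInitializable (E A : Matrix (Fin ℓ) (Fin n) 𝕜) (B : Matrix (Fin ℓ) (Fin m) 𝕜) : Prop :=
  ∀ x₀ : Fin n → 𝕜, ∃ w ∈ behaviour E A B, HasValueAt w.1 0 x₀

/-- Here and in `StronglyControllable`, `E x` is continuous, so its point values are meaningful. -/
def ImpulseControllable (E A : Matrix (Fin ℓ) (Fin n) 𝕜) (B : Matrix (Fin ℓ) (Fin m) 𝕜) : Prop :=
  ∀ x₀ : Fin n → 𝕜, ∃ w ∈ behaviour E A B, E *ᵥ w.1 0 = E *ᵥ x₀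

def BehaviourallyControllable (E A : Matrix (Fin ℓ) (Fin n) 𝕜) (B : Matrix (Fin ℓ) (Fin m) 𝕜) :
    Prop :=
  ∀ w₁ ∈ behaviour E A B, ∀ w₂ ∈ behaviour E A B, ∃ T : ℝ, 0 < T ∧ ∃ w ∈ behaviour E A B,
    (∀ t < 0, w.1 t = w₁.1 t ∧ w.2 t = w₁.2 t) ∧ (∀ t > T, w.1 t = w₂.1 t ∧ w.2 t = w₂.2 t)

def CompletelyControllable (E A : Matrix (Fin ℓ) (Fin n) 𝕜) (B : Matrix (Fin ℓ) (Fin m) 𝕜) :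
    Prop :=
  ∃ T : ℝ, 0 < T ∧ ∀ x₀ x_T : Fin n → 𝕜, ∃ w ∈ behaviour E A B,
    HasValueAt w.1 0 x₀ ∧ HasValueAt w.1 T x_T

def StronglyControllable (E A : Matrix (Fin ℓ) (Fin n) 𝕜) (B : Matrix (Fin ℓ) (Fin m) 𝕜) :
    Prop :=
  ∃ T : ℝ, 0 < T ∧ ∀ x₀ x_T : Fin n → 𝕜, ∃ w ∈ behaviour E A B,
    E *ᵥ w.1 0 = E *ᵥ x₀ ∧ E *ᵥ w.1 T = E *ᵥ x_T

end DAE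

/-- Names of the five controllability concepts. -/
inductive CtrlConcept
  | freelyInitializable
  | impulseControllable
  | behaviourallyControllable
  | completelyControllable
  | stronglyControllable

/-- The system `d/dt (E x) = A x + B u` has the controllability property named by the concept. -/
def CtrlConcept.Holds {𝕜 : Type*} [RCLike 𝕜] {ℓ n m : ℕ} (c : CtrlConcept)
    (E A : Matrix (Fin ℓ) (Fin n) 𝕜) (B : Matrix (Fin ℓ) (Fin m) 𝕜) : Prop :=
  match c with
  | .freelyInitializable => FreelyInitializable E A B
  | .impulseControllable => ImpulseControllable E A B
  | .behaviourallyControllable => BehaviourallyControllable E A B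
  | .completelyControllable => CompletelyControllable E A B
  | .stronglyControllable => StronglyControllable E A B

/-! ### Port-Hamiltonian systems -/

section Classes

variable (𝕜 : Type*) [RCLike 𝕜] (ℓ n m : ℕ)

/-- Quadruples `(E, J, Q, B)`. -/
abbrev Quadruple : Type _ :=
  Matrix (Fin ℓ) (Fin n) 𝕜 × Matrix (Fin ℓ) (Fin ℓ) 𝕜 × Matrix (Fin ℓ) (Fin n) 𝕜 ×
    Matrix (Fin ℓ) (Fin m) 𝕜

/-- Quintuples `(E, J, R, Q, B)`. -/
abbrev Quintuple : Type _ :=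
  Matrix (Fin ℓ) (Fin n) 𝕜 × Matrix (Fin ℓ) (Fin ℓ) 𝕜 × Matrix (Fin ℓ) (Fin ℓ) 𝕜 ×
    Matrix (Fin ℓ) (Fin n) 𝕜 × Matrix (Fin ℓ) (Fin m) 𝕜

/-- `Σ^H`: conservative systems, `J = -J*`, `E*Q = Q*E ≥ 0`. -/
def SigmaH : Set (Quadruple 𝕜 ℓ n m) :=
  {(E, J, Q, _B) | J = -Jᴴ ∧ Eᴴ * Q = Qᴴ * E ∧ (Eᴴ * Q).PosSemidef}

/-- `Σ^sdH`: semi-dissipative systems, `J = -J*`, `R = R* ≥ 0`, `E*Q = Q*E ≥ 0`. -/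
def SigmaSdH : Set (Quintuple 𝕜 ℓ n m) :=
  {(E, J, R, Q, _B) | J = -Jᴴ ∧ R = Rᴴ ∧ R.PosSemidef ∧ Eᴴ * Q = Qᴴ * E ∧ (Eᴴ * Q).PosSemidef}

/-- `Σ^dH`: dissipative systems, `J = -J*`, `R = R* > 0`, `E*Q = Q*E ≥ 0`. -/
def SigmaDH : Set (Quintuple 𝕜 ℓ n m) :=
  {(E, J, R, Q, _B) | J = -Jᴴ ∧ R = Rᴴ ∧ R.PosDef ∧ Eᴴ * Q = Qᴴ * E ∧ (Eᴴ * Q).PosSemidef}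

/-- The systems in `Σ^H` with the given controllability property. -/
def ctrlH (c : CtrlConcept) : Set (Quadruple 𝕜 ℓ n m) :=
  {(E, J, Q, B) | (E, J, Q, B) ∈ SigmaH 𝕜 ℓ n m ∧ c.Holds E (J * Q) B}

/-- The systems in `Σ^sdH` with the given controllability property. -/
def ctrlSdH (c : CtrlConcept) : Set (Quintuple 𝕜 ℓ n m) :=
  {(E, J, R, Q, B) | (E, J, R, Q, B) ∈ SigmaSdH 𝕜 ℓ n m ∧ c.Holds E ((J - R) * Q) B}

/-- The systems in `Σ^dH` with the given controllability property. -/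
def ctrlDH (c : CtrlConcept) : Set (Quintuple 𝕜 ℓ n m) :=
  {(E, J, R, Q, B) | (E, J, R, Q, B) ∈ SigmaDH 𝕜 ℓ n m ∧ c.Holds E ((J - R) * Q) B}

end Classes

end PortHamiltonian

open PortHamiltonian

/-! Genericity is always witnessed by a single polynomial: the squared modulus of a determinant
whose entries are affine in `(E, A, B)`, with `A = J * Q` or `A = (J - R) * Q`. The work splits into
density of its nonvanishing locus and a choice of determinant that decides all five concepts.

Density. The relation `Eᴴ * Q = Qᴴ * E ≥ 0` cuts out a set that is neither convex nor open, so a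
nonzero polynomial could vanish on a large part of it. But `(E, Q)` is the limit of `(E + ε • Q,
Q)`, and there `Q = T * (E + ε • Q)` with `T ≥ 0` (`exists_posSemidef_factor`). A pair `(E, T * E)`
is joined to `(E₁, E₁)` by moving `E` and `T` along segments and taking `T_t * E_t` for the second
entry. This path stays in the class and is polynomial in `t`, so a determinant that is nonzero at
the far end vanishes only finitely often on it. Since `R` can be shrunk to `0` on the way, one
example `[E₁, J₁ * E₁, B₁]` serves all three classes.

Choice of determinant (`genericCondition_holds_iff_expected`). For `ℓ < n + m`, steering between
arbitrary states by polynomial trajectories is surjectivity of a linear operator between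
finite-dimensional spaces; complete controllability implies the other four concepts. For `ℓ = n +
m`, the map `(v, u) ↦ E v - B u` is bijective. The system is then a linear ODE for `x` with `u`
determined by `x`: every initial value occurs, but the future is determined, so nothing can be
steered. For `ℓ > n + m`, the array of differentiated equations is injective, which forces `x = 0`.
Gluing is then trivial, while nonzero initial values are impossible. In each regime a tridiagonal
skew matrix supplies the example.

Finally, a set and its complement cannot both be relative generic in a nonempty set
(`RelGeneric.not_compl`), which turns these implications into equivalences. -/

namespace PortHamiltonian

/-! ### Polynomial maps between real vector spaces -/

section PolyMap

/-- The algebra of real polynomial functions on a real vector space. -/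
def polyFun (Y : Type*) [AddCommGroup Y] [Module ℝ Y] : Subalgebra ℝ (Y → ℝ) :=
  Algebra.adjoin ℝ (Set.range fun g : Module.Dual ℝ Y => (g : Y → ℝ))

/-- A map into a real vector space is polynomial if its composites with linear functionals are. -/
def PolyMap {Y W : Type*} [AddCommGroup Y] [Module ℝ Y] [AddCommGroup W] [Module ℝ W]
    (h : Y → W) : Prop :=
  ∀ g : Module.Dual ℝ W, (fun y => g (h y)) ∈ polyFun Y

variable {Y W W₁ W₂ : Type*} [AddCommGroup Y] [Module ℝ Y] [AddCommGroup W] [Module ℝ W]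
  [AddCommGroup W₁] [Module ℝ W₁] [AddCommGroup W₂] [Module ℝ W₂]

theorem PolyMap.of_linear (L : Y →ₗ[ℝ] W) : PolyMap (fun y => L y) := fun g =>
  Algebra.subset_adjoin ⟨g ∘ₗ L, rfl⟩

theorem PolyMap.const (w : W) : PolyMap (fun _ : Y => w) := fun g =>
  (polyFun Y).algebraMap_mem (g w)

theorem PolyMap.add {h k : Y → W} (hh : PolyMap h) (hk : PolyMap k) :
    PolyMap (fun y => h y + k y) := fun g => by
  simp only [map_add]
  exact (polyFun Y).add_mem (hh g) (hk g)

theorem PolyMap.sum {ι : Type*} (s : Finset ι) {h : ι → Y → W} (hh : ∀ i ∈ s, PolyMap (h i)) :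
    PolyMap (fun y => ∑ i ∈ s, h i y) := fun g => by
  have := (polyFun Y).sum_mem (fun i hi => hh i hi g)
  convert this using 1
  ext y
  simp

theorem PolyMap.linear_comp (L : W →ₗ[ℝ] W₁) {h : Y → W} (hh : PolyMap h) :
    PolyMap (fun y => L (h y)) := fun g => hh (g ∘ₗ L)

theorem PolyMap.sub {h k : Y → W} (hh : PolyMap h) (hk : PolyMap k) :
    PolyMap (fun y => h y - k y) := fun g => by
  simp only [map_sub]
  exact (polyFun Y).sub_mem (hh g) (hk g)

theorem PolyMap.fst {h : Y → W₁ × W₂} (hh : PolyMap h) : PolyMap (fun y => (h y).1) :=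
  hh.linear_comp (LinearMap.fst ℝ W₁ W₂)

theorem PolyMap.snd {h : Y → W₁ × W₂} (hh : PolyMap h) : PolyMap (fun y => (h y).2) :=
  hh.linear_comp (LinearMap.snd ℝ W₁ W₂)

theorem PolyMap.prodMk {h : Y → W₁} {k : Y → W₂} (hh : PolyMap h) (hk : PolyMap k) :
    PolyMap (fun y => (h y, k y)) := by
  have := (hh.linear_comp (LinearMap.inl ℝ W₁ W₂)).add (hk.linear_comp (LinearMap.inr ℝ W₁ W₂))
  simpa using this

/-- Expanding the first argument in a basis `e` writes a functional of `b (h y) (k y)` as a finite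
sum of products of a coordinate of `h y` and a linear functional of `k y`. -/
theorem PolyMap.bilinear [FiniteDimensional ℝ W₁] (b : W₁ →ₗ[ℝ] W₂ →ₗ[ℝ] W) {h : Y → W₁}
    {k : Y → W₂} (hh : PolyMap h) (hk : PolyMap k) : PolyMap (fun y => b (h y) (k y)) := fun g => by
  let e := Module.finBasis ℝ W₁
  have key : (fun y => g (b (h y) (k y))) =
      ∑ i, (fun y => e.coord i (h y)) * (fun y => (g ∘ₗ b (e i)) (k y)) := by
    ext y
    conv_lhs => rw [← e.sum_repr (h y)]
    simp [-Module.Basis.sum_repr]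
  rw [key]
  exact (polyFun Y).sum_mem fun i _ => (polyFun Y).mul_mem (hh _) (hk _)

theorem PolyMap.smul {h : Y → ℝ} {k : Y → W} (hh : PolyMap h) (hk : PolyMap k) :
    PolyMap (fun y => h y • k y) :=
  PolyMap.bilinear (LinearMap.lsmul ℝ W) hh hk

variable {𝕜 : Type*} [RCLike 𝕜]

theorem PolyMap.mul {h k : Y → 𝕜} (hh : PolyMap h) (hk : PolyMap k) :
    PolyMap (fun y => h y * k y) :=
  PolyMap.bilinear (LinearMap.mul ℝ 𝕜) hh hk

theorem PolyMap.prod {ι : Type*} (s : Finset ι) {h : ι → Y → 𝕜} (hh : ∀ i ∈ s, PolyMap (h i)) :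
    PolyMap (fun y => ∏ i ∈ s, h i y) := by
  classical
  induction s using Finset.induction_on with
  | empty => simpa using PolyMap.const (1 : 𝕜)
  | insert a s ha ih =>
    simp only [Finset.prod_insert ha]
    exact (hh a (by simp)).mul (ih fun i hi => hh i (by simp [hi]))

theorem PolyMap.matrix_mul {a b c : ℕ} {h : Y → Matrix (Fin a) (Fin b) 𝕜}
    {k : Y → Matrix (Fin b) (Fin c) 𝕜} (hh : PolyMap h) (hk : PolyMap k) :
    PolyMap (fun y => h y * k y) :=
  PolyMap.bilinear (LinearMap.mk₂ ℝ (fun M N => M * N) Matrix.add_mul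
    (fun r M N => Matrix.smul_mul r M N) Matrix.mul_add (fun r M N => Matrix.mul_smul M r N)) hh hk

theorem PolyMap.entry {ι κ : Type*} {h : Y → Matrix ι κ 𝕜} (hh : PolyMap h) (i : ι) (j : κ) :
    PolyMap (fun y => h y i j) :=
  hh.linear_comp (Matrix.entryLinearMap ℝ 𝕜 i j)

theorem PolyMap.det {κ : Type*} [Fintype κ] [DecidableEq κ] {h : Y → Matrix κ κ 𝕜}
    (hh : PolyMap h) : PolyMap (fun y => (h y).det) := by
  simp only [Matrix.det_apply']
  exact PolyMap.sum _ fun σ _ => (PolyMap.const _).mul (PolyMap.prod _ fun i _ => hh.entry (σ i) i)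

theorem PolyMap.normSq_mem {h : Y → 𝕜} (hh : PolyMap h) :
    (fun y => RCLike.normSq (h y)) ∈ polyFun Y := by
  have h1 := hh RCLike.reLm
  have h2 := hh RCLike.imLm
  have := (polyFun Y).add_mem ((polyFun Y).mul_mem h1 h1) ((polyFun Y).mul_mem h2 h2)
  convert this using 1
  ext y
  simp [RCLike.normSq_apply]

theorem exists_polynomial_of_mem_polyFun {f : ℝ → ℝ} (hf : f ∈ polyFun ℝ) :
    ∃ p : Polynomial ℝ, ∀ t, p.eval t = f t := by
  induction hf using Algebra.adjoin_induction with
  | mem x hx =>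
    obtain ⟨g, rfl⟩ := hx
    refine ⟨Polynomial.C (g 1) * Polynomial.X, fun t => ?_⟩
    have : g t = t * g 1 := by
      rw [← smul_eq_mul, ← map_smul, smul_eq_mul, mul_one]
    rw [Polynomial.eval_mul, Polynomial.eval_C, Polynomial.eval_X, mul_comm]
    exact this.symm
  | algebraMap r => exact ⟨Polynomial.C r, fun t => by simp⟩
  | add x y _ _ hx hy =>
    obtain ⟨p, hp⟩ := hx
    obtain ⟨q, hq⟩ := hy
    exact ⟨p + q, fun t => by simp [hp, hq]⟩
  | mul x y _ _ hx hy =>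
    obtain ⟨p, hp⟩ := hx
    obtain ⟨q, hq⟩ := hy
    exact ⟨p * q, fun t => by simp [hp, hq]⟩

/-- The value at `s` shows that the polynomial is nonzero; its roots are then finite in number and
cannot accumulate at `a`. -/
theorem eventually_ne_zero_of_mem_polyFun {f : ℝ → ℝ} (hf : f ∈ polyFun ℝ) {s : ℝ} (hs : f s ≠ 0)
    (a : ℝ) : ∀ᶠ t in nhdsWithin a (Set.Ioi a), f t ≠ 0 := by
  obtain ⟨p, hp⟩ := exists_polynomial_of_mem_polyFun hf
  have hp0 : p ≠ 0 := by
    rintro rfl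
    exact hs (by rw [← hp]; simp)
  have hfin : {t | p.IsRoot t}.Finite := Polynomial.finite_setOfPred_isRoot hp0
  have h1 : ∀ᶠ t in nhdsWithin a {a}ᶜ, t ∉ {t | p.IsRoot t} := by
    have := hfin.subset (Set.sdiff_subset (t := {a}))
    have h2 : ({t | p.IsRoot t} \ {a})ᶜ ∈ nhds a :=
      this.isClosed.isOpen_compl.mem_nhds (by simp)
    filter_upwards [mem_nhdsWithin_of_mem_nhds h2, self_mem_nhdsWithin] with t ht hta
    intro h
    exact ht ⟨h, hta⟩
  have h2 := h1.filter_mono (nhdsWithin_mono a (fun t (ht : a < t) => ne_of_gt ht))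
  filter_upwards [h2] with t ht h
  exact ht (by simp [Polynomial.IsRoot, hp, h])

theorem exists_mvPolynomial_of_mem_polyFun {N : ℕ} (φ : Y ≃ₗ[ℝ] (Fin N → ℝ)) {f : Y → ℝ}
    (hf : f ∈ polyFun Y) :
    ∃ p : MvPolynomial (Fin N) ℝ, ∀ y, MvPolynomial.eval (φ y) p = f y := by
  induction hf using Algebra.adjoin_induction with
  | mem x hx =>
    obtain ⟨g, rfl⟩ := hx
    refine ⟨∑ i, MvPolynomial.C (g (φ.symm (Pi.single i 1))) * MvPolynomial.X i, fun y => ?_⟩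
    have : y = ∑ i, φ y i • φ.symm (Pi.single i 1) := by
      apply φ.injective
      simp only [map_sum, map_smul, LinearEquiv.apply_symm_apply]
      exact pi_eq_sum_univ' (φ y)
    conv_rhs => rw [this]
    simp [mul_comm]
  | algebraMap r => exact ⟨MvPolynomial.C r, fun t => by simp⟩
  | add x y _ _ hx hy =>
    obtain ⟨p, hp⟩ := hx
    obtain ⟨q, hq⟩ := hy
    exact ⟨p + q, fun t => by simp [hp, hq]⟩
  | mul x y _ _ hx hy =>
    obtain ⟨p, hp⟩ := hx
    obtain ⟨q, hq⟩ := hy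
    exact ⟨p * q, fun t => by simp [hp, hq]⟩

end PolyMap

/-! ### Criteria for relative genericity -/

section Generic

/-- One good point at the end of a polynomial path makes its start a limit of good points. The
endpoint `γ 1` need not lie in `V`; this is what permits `R = 0` there for the dissipative class. -/
theorem mem_closure_of_polyMap_path
    {X : Type*} [TopologicalSpace X] {V : Set X} {f : X → ℝ} {γ : ℝ → X} (hγ : ContinuousAt γ 0)
    (hV : ∀ t, 0 < t → t < 1 → γ t ∈ V) (hf : (fun t => f (γ t)) ∈ polyFun ℝ)
    (h1 : f (γ 1) ≠ 0) : γ 0 ∈ closure {x ∈ V | f x ≠ 0} := by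
  refine mem_closure_of_tendsto (hγ.mono_left (nhdsWithin_le_nhds (s := Set.Ioi 0))) ?_
  filter_upwards [eventually_ne_zero_of_mem_polyFun hf h1 0, Ioo_mem_nhdsGT one_pos] with t ht ht1
  exact ⟨hV t ht1.1 ht1.2, ht⟩

variable {X : Type*} [AddCommGroup X] [Module ℝ X] [TopologicalSpace X] [IsTopologicalAddGroup X]
  [ContinuousSMul ℝ X] [T2Space X] {S V : Set X}

theorem relGeneric_of_polyFun [FiniteDimensional ℝ X] {f : X → ℝ} (hf : f ∈ polyFun X)
    (hS : ∀ x ∈ V, f x ≠ 0 → x ∈ S) (hV : V ⊆ closure {x ∈ V | f x ≠ 0}) : RelGeneric S V := by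
  let φ : X ≃ₗ[ℝ] (Fin (Module.finrank ℝ X) → ℝ) := (Module.finBasis ℝ X).equivFun
  have hφ : Continuous φ := φ.toLinearMap.continuous_of_finiteDimensional
  obtain ⟨p, hp⟩ := exists_mvPolynomial_of_mem_polyFun φ hf
  refine ⟨_, φ, {x | MvPolynomial.eval x p = 0}, ⟨1, fun _ => p, by simp⟩, ?_, ?_⟩
  · rintro _ ⟨hxS, x, hx, rfl⟩
    refine ⟨?_, x, hx, rfl⟩
    by_contra h
    exact hxS ⟨x, hS x hx (by rwa [← hp]), rfl⟩
  · rintro _ ⟨x, hx, rfl⟩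
    have := image_closure_subset_closure_image hφ ⟨x, hV hx, rfl⟩
    refine closure_mono ?_ this
    rintro _ ⟨y, ⟨hy, hy0⟩, rfl⟩
    exact ⟨by simpa [hp] using hy0, y, hy, rfl⟩

/-- Keeps only the topological content of genericity: algebraic sets are closed, and linear
coordinates are homeomorphisms. -/
theorem RelGeneric.exists_isClosed (h : RelGeneric S V) :
    ∃ W : Set X, IsClosed W ∧ (∀ x ∈ V, x ∉ W → x ∈ S) ∧ V ⊆ closure (Wᶜ ∩ V) := by
  obtain ⟨N, φ, W, ⟨k, p, rfl⟩, hS, hd⟩ := h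
  have : FiniteDimensional ℝ X := φ.symm.finiteDimensional
  have hφ : Continuous φ := φ.toLinearMap.continuous_of_finiteDimensional
  have hφ' : Continuous φ.symm := φ.symm.toLinearMap.continuous_of_finiteDimensional
  refine ⟨φ ⁻¹' {x | ∀ i, MvPolynomial.eval x (p i) = 0}, ?_, ?_, ?_⟩
  · refine IsClosed.preimage hφ ?_
    simp only [Set.ofPred_forall]
    exact isClosed_iInter fun i => isClosed_eq (MvPolynomial.continuous_eval (p i)) continuous_const
  · intro x hx hxW
    by_contra hxS
    refine hxW (hS ⟨?_, x, hx, rfl⟩).1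
    rintro ⟨y, hy, hyx⟩
    exact hxS (φ.injective hyx ▸ hy)
  · intro x hx
    have := image_closure_subset_closure_image hφ' ⟨φ x, hd ⟨x, hx, rfl⟩, rfl⟩
    rw [LinearEquiv.symm_apply_apply] at this
    refine closure_mono ?_ this
    rintro _ ⟨_, ⟨hy, y, hyV, rfl⟩, rfl⟩
    rw [LinearEquiv.symm_apply_apply]
    exact ⟨hy, hyV⟩

/-- Two relatively open dense subsets of a nonempty set meet; a common point would lie both in `S`
and in `Sᶜ`. -/
theorem RelGeneric.not_compl (h : RelGeneric S V) (hV : V.Nonempty) : ¬ RelGeneric Sᶜ V := by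
  intro h'
  obtain ⟨W, hW, hWS, hd⟩ := h.exists_isClosed
  obtain ⟨W', hW', hWS', hd'⟩ := h'.exists_isClosed
  obtain ⟨v, hv⟩ := hV
  obtain ⟨x, hx, hxV⟩ := closure_nonempty_iff.1 ⟨v, hd hv⟩
  obtain ⟨y, hyW, hyW', hyV⟩ := mem_closure_iff.1 (hd' hxV) _ hW.isOpen_compl hx
  exact hWS' y hyV hyW' (hWS y hyV hyW)

end Generic

/-! ### Dense subsets of the port-Hamiltonian classes -/

section Density

variable {𝕜 : Type*} [RCLike 𝕜] {ℓ n m : ℕ}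

theorem finite_prod_matrix (a b : ℕ) (W : Type*) [AddCommGroup W] [Module ℝ W]
    [Module.Finite ℝ W] : Module.Finite ℝ (Matrix (Fin a) (Fin b) 𝕜 × W) :=
  Module.Finite.prod

instance : FiniteDimensional ℝ (Quadruple 𝕜 ℓ n m) :=
  have := finite_prod_matrix (𝕜 := 𝕜) ℓ n (Matrix (Fin ℓ) (Fin m) 𝕜)
  have := finite_prod_matrix (𝕜 := 𝕜) ℓ ℓ (Matrix (Fin ℓ) (Fin n) 𝕜 × Matrix (Fin ℓ) (Fin m) 𝕜)
  finite_prod_matrix ℓ n _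

instance : FiniteDimensional ℝ (Quintuple 𝕜 ℓ n m) :=
  have : FiniteDimensional ℝ (Matrix (Fin ℓ) (Fin ℓ) 𝕜 × Matrix (Fin ℓ) (Fin ℓ) 𝕜 ×
      Matrix (Fin ℓ) (Fin n) 𝕜 × Matrix (Fin ℓ) (Fin m) 𝕜) :=
    have := finite_prod_matrix (𝕜 := 𝕜) ℓ n (Matrix (Fin ℓ) (Fin m) 𝕜)
    have := finite_prod_matrix (𝕜 := 𝕜) ℓ ℓ (Matrix (Fin ℓ) (Fin n) 𝕜 × Matrix (Fin ℓ) (Fin m) 𝕜)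
    finite_prod_matrix ℓ ℓ _
  finite_prod_matrix ℓ n _

/-- A pseudo-inverse by functional calculus: `x * x⁻¹ * x = x` holds also at `0`, and continuity is
automatic on a finite spectrum. -/
theorem exists_isHermitian_mul_mul_self {k : ℕ} {P : Matrix (Fin k) (Fin k) 𝕜}
    (hP : P.IsHermitian) : ∃ H : Matrix (Fin k) (Fin k) 𝕜, H.IsHermitian ∧ P * H * P = P := by
  have hsa : IsSelfAdjoint P := hP
  have hc : ∀ f : ℝ → ℝ, ContinuousOn f (spectrum ℝ P) := fun f =>
    (Matrix.finite_real_spectrum (A := P)).continuousOn f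
  refine ⟨cfc (fun x : ℝ => x⁻¹) P, cfc_predicate (fun x : ℝ => x⁻¹) P, ?_⟩
  have h1 : P * cfc (fun x : ℝ => x⁻¹) P * P =
      cfc (fun x : ℝ => x * x⁻¹ * x) P := by
    rw [cfc_mul (fun x : ℝ => x * x⁻¹) (fun x => x) P (hc _) (hc _),
      cfc_mul (fun x : ℝ => x) (fun x => x⁻¹) P (hc _) (hc _), cfc_id' ℝ P]
  rw [h1]
  simp only [mul_inv_mul_cancel]
  exact cfc_id' ℝ P

/-- Near any pair with `Eᴴ Q = Qᴴ E ≥ 0` there are pairs in which `Q` factors through `E` by a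
positive semidefinite matrix. -/
theorem exists_posSemidef_factor {E Q : Matrix (Fin ℓ) (Fin n) 𝕜} (hEQ : Eᴴ * Q = Qᴴ * E)
    (hpos : (Eᴴ * Q).PosSemidef) {ε : ℝ} (hε : 0 < ε) :
    ∃ T : Matrix (Fin ℓ) (Fin ℓ) 𝕜, T.PosSemidef ∧ Q = T * (E + ε • Q) := by
  set P := (E + ε • Q)ᴴ * Q with hPdef
  have hP : P = Eᴴ * Q + ε • (Qᴴ * Q) := by
    simp [hPdef, Matrix.conjTranspose_add, Matrix.conjTranspose_smul, Matrix.add_mul]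
  have hQQ : (Qᴴ * Q).PosSemidef := Matrix.posSemidef_conjTranspose_mul_self Q
  have hPpos : P.PosSemidef := by
    rw [hP]
    exact hpos.add (hQQ.smul hε.le)
  have hP' : Qᴴ * (E + ε • Q) = P := by
    rw [hP, Matrix.mul_add, hEQ, Matrix.mul_smul]
  obtain ⟨H, hH, hPHP⟩ := exists_isHermitian_mul_mul_self hPpos.isHermitian
  -- The kernel of `P` lies in that of `Q`: `P * X = 0` gives `Xᴴ * P * X = 0`, a sum of two
  -- positive semidefinite terms, one of which is `ε • (Q * X)ᴴ * (Q * X)`.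
  have key : Q * (H * P - 1) = 0 := by
    set X := H * P - 1
    have hPX : P * X = 0 := by
      simp only [X, Matrix.mul_sub, ← Matrix.mul_assoc, hPHP, Matrix.mul_one, sub_self]
    have h0 : Xᴴ * (Eᴴ * Q) * X + ε • ((Q * X)ᴴ * (Q * X)) = 0 := by
      have : Xᴴ * P * X = 0 := by rw [Matrix.mul_assoc, hPX, Matrix.mul_zero]
      rw [hP] at this
      rw [← this]
      simp [Matrix.mul_add, Matrix.add_mul, Matrix.mul_assoc]
    have h1 := (hpos.conjTranspose_mul_mul_same X).trace_nonneg
    have h2 := ((Matrix.posSemidef_conjTranspose_mul_self (Q * X)).smul hε.le).trace_nonneg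
    have h3 := congrArg Matrix.trace h0
    rw [Matrix.trace_add, Matrix.trace_zero] at h3
    have h4 := ((add_eq_zero_iff_of_nonneg h1 h2).1 h3).2
    rw [Matrix.trace_smul, smul_eq_zero_iff_right hε.ne',
      Matrix.trace_conjTranspose_mul_self_eq_zero_iff] at h4
    exact h4
  -- A congruence of `P`, hence visibly positive semidefinite. Since `Qᴴ * (E + ε • Q) = P`,
  -- applying it to `E + ε • Q` gives `Q * H * P * H * P = Q * H * P = Q`.
  refine ⟨(Q * H) * P * (Q * H)ᴴ, hPpos.mul_mul_conjTranspose_same (Q * H), ?_⟩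
  rw [Matrix.mul_sub, Matrix.mul_one, sub_eq_zero] at key
  calc Q = Q * (H * (P * H * P)) := by rw [hPHP, key]
    _ = (Q * H) * P * (Q * H)ᴴ * (E + ε • Q) := by
      rw [Matrix.conjTranspose_mul, hH.eq, Matrix.mul_assoc _ (H * Qᴴ), Matrix.mul_assoc H Qᴴ, hP']
      simp only [Matrix.mul_assoc]

/-- The straight path from `a` to `b`. -/
def segmentPath {W : Type*} [AddCommGroup W] [Module ℝ W] (a b : W) (t : ℝ) : W :=
  (1 - t) • a + t • b

section segmentPath

variable {W : Type*} [AddCommGroup W] [Module ℝ W] (a b : W)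

@[simp] theorem segmentPath_zero : segmentPath a b 0 = a := by simp [segmentPath]

@[simp] theorem segmentPath_one : segmentPath a b 1 = b := by simp [segmentPath]

theorem polyMap_segmentPath : PolyMap (segmentPath a b) := by
  have h : PolyMap (fun t : ℝ => t) := PolyMap.of_linear LinearMap.id
  exact (((PolyMap.const (1 : ℝ)).sub h).smul (PolyMap.const a)).add (h.smul (PolyMap.const b))

theorem continuous_segmentPath [TopologicalSpace W] [IsTopologicalAddGroup W]
    [ContinuousSMul ℝ W] : Continuous (segmentPath a b) := by
  unfold segmentPath
  fun_prop

end segmentPath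

theorem segmentPath_skew {J J' : Matrix (Fin ℓ) (Fin ℓ) 𝕜} (h : J = -Jᴴ) (h' : J' = -J'ᴴ) (t : ℝ) :
    segmentPath J J' t = -(segmentPath J J' t)ᴴ := by
  simp only [segmentPath, Matrix.conjTranspose_add, Matrix.conjTranspose_smul, star_trivial,
    neg_add, ← smul_neg, ← h, ← h']

theorem segmentPath_posSemidef {T T' : Matrix (Fin ℓ) (Fin ℓ) 𝕜} (h : T.PosSemidef)
    (h' : T'.PosSemidef) {t : ℝ} (ht : 0 < t) (ht' : t < 1) :
    (segmentPath T T' t).PosSemidef :=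
  (h.smul (sub_nonneg.2 ht'.le)).add (h'.smul ht.le)

theorem mul_factor_isHermitian {T : Matrix (Fin ℓ) (Fin ℓ) 𝕜} (hT : T.PosSemidef)
    (E : Matrix (Fin ℓ) (Fin n) 𝕜) :
    Eᴴ * (T * E) = (T * E)ᴴ * E ∧ (Eᴴ * (T * E)).PosSemidef := by
  refine ⟨by rw [Matrix.conjTranspose_mul, hT.isHermitian.eq, Matrix.mul_assoc], ?_⟩
  rw [← Matrix.mul_assoc]
  exact hT.conjTranspose_mul_mul_same E

variable {κ : Type*} [Fintype κ] [DecidableEq κ]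

/-- The determinant of a square matrix depending affinely on the system matrices. -/
def pencilDet
    (Θ : (Matrix (Fin ℓ) (Fin n) 𝕜 × Matrix (Fin ℓ) (Fin n) 𝕜 × Matrix (Fin ℓ) (Fin m) 𝕜) →ₗ[𝕜]
      Matrix κ κ 𝕜) (C : Matrix κ κ 𝕜)
    (E A : Matrix (Fin ℓ) (Fin n) 𝕜) (B : Matrix (Fin ℓ) (Fin m) 𝕜) : 𝕜 :=
  (Θ (E, A, B) + C).det

variable
  (Θ : (Matrix (Fin ℓ) (Fin n) 𝕜 × Matrix (Fin ℓ) (Fin n) 𝕜 × Matrix (Fin ℓ) (Fin m) 𝕜) →ₗ[𝕜]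
    Matrix κ κ 𝕜) (C : Matrix κ κ 𝕜)

theorem normSq_pencilDet_mem {Y : Type*} [AddCommGroup Y] [Module ℝ Y]
    {E A : Y → Matrix (Fin ℓ) (Fin n) 𝕜} {B : Y → Matrix (Fin ℓ) (Fin m) 𝕜}
    (hE : PolyMap E) (hA : PolyMap A) (hB : PolyMap B) :
    (fun y => RCLike.normSq (pencilDet Θ C (E y) (A y) (B y))) ∈ polyFun Y :=
  ((((hE.prodMk (hA.prodMk hB)).linear_comp (Θ.restrictScalars ℝ)).add
    (PolyMap.const C)).det).normSq_mem

variable {E₁ : Matrix (Fin ℓ) (Fin n) 𝕜} {J₁ : Matrix (Fin ℓ) (Fin ℓ) 𝕜}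
  {B₁ : Matrix (Fin ℓ) (Fin m) 𝕜}

/-- A determinantal condition which holds for some system `[E₁, J₁ E₁, B₁]` defines a relative
generic subset of `Σ^H`. -/
theorem relGeneric_sigmaH (hJ₁ : J₁ = -J₁ᴴ) (h₁ : pencilDet Θ C E₁ (J₁ * E₁) B₁ ≠ 0)
    {S : Set (Quadruple 𝕜 ℓ n m)}
    (hS : ∀ E J Q B, (E, J, Q, B) ∈ SigmaH 𝕜 ℓ n m → pencilDet Θ C E (J * Q) B ≠ 0 →
      (E, J, Q, B) ∈ S) : RelGeneric S (SigmaH 𝕜 ℓ n m) := by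
  let f : Quadruple 𝕜 ℓ n m → ℝ := fun x =>
    RCLike.normSq (pencilDet Θ C x.1 (x.2.1 * x.2.2.1) x.2.2.2)
  have hid : PolyMap (fun x : Quadruple 𝕜 ℓ n m => x) := PolyMap.of_linear LinearMap.id
  have hf : f ∈ polyFun (Quadruple 𝕜 ℓ n m) :=
    normSq_pencilDet_mem Θ C hid.fst (hid.snd.fst.matrix_mul hid.snd.snd.fst) hid.snd.snd.snd
  refine relGeneric_of_polyFun hf (fun ⟨E, J, Q, B⟩ hx h => hS E J Q B hx ?_) ?_
  · simpa [f] using h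
  have hpath : ∀ (E J B) (T : Matrix (Fin ℓ) (Fin ℓ) 𝕜), J = -Jᴴ → T.PosSemidef →
      (E, J, T * E, B) ∈ closure {x ∈ SigmaH 𝕜 ℓ n m | f x ≠ 0} := by
    intro E J B T hJ hT
    -- Moving `T` to `1` makes the third entry end at `E₁`, so the determinant at `t = 1` is the one
    -- of the example.
    let γ : ℝ → Quadruple 𝕜 ℓ n m := fun t => (segmentPath E E₁ t, segmentPath J J₁ t,
      segmentPath T 1 t * segmentPath E E₁ t, segmentPath B B₁ t)
    have h0 : γ 0 = (E, J, T * E, B) := by simp [γ]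
    rw [← h0]
    refine mem_closure_of_polyMap_path (Continuous.continuousAt ?_) ?_ ?_ ?_
    · exact (continuous_segmentPath _ _).prodMk ((continuous_segmentPath _ _).prodMk
        (((continuous_segmentPath _ _).matrix_mul (continuous_segmentPath _ _)).prodMk
          (continuous_segmentPath _ _)))
    · intro t ht ht'
      exact ⟨segmentPath_skew hJ hJ₁ t,
        mul_factor_isHermitian (segmentPath_posSemidef hT Matrix.PosSemidef.one ht ht') _⟩
    · exact normSq_pencilDet_mem Θ C (polyMap_segmentPath _ _)
        ((polyMap_segmentPath _ _).matrix_mul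
          ((polyMap_segmentPath _ _).matrix_mul (polyMap_segmentPath _ _)))
        (polyMap_segmentPath _ _)
    · simpa [f, γ] using h₁
  rintro ⟨E, J, Q, B⟩ ⟨hJ, hEQ, hpos⟩
  -- Points whose `Q` factors are already in the closure; a general point is a limit of those as `ε`
  -- tends to `0` from above.
  rw [← closure_closure]
  have hlim : Filter.Tendsto (fun ε : ℝ => ((E + ε • Q, J, Q, B) : Quadruple 𝕜 ℓ n m))
      (nhdsWithin 0 (Set.Ioi 0)) (nhds (E, J, Q, B)) := by
    have : Continuous (fun ε : ℝ => ((E + ε • Q, J, Q, B) : Quadruple 𝕜 ℓ n m)) := by fun_prop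
    simpa using this.continuousAt.mono_left (nhdsWithin_le_nhds (a := (0 : ℝ)) (s := Set.Ioi 0))
  refine mem_closure_of_tendsto hlim ?_
  filter_upwards [self_mem_nhdsWithin] with ε hε
  obtain ⟨T, hT, hQ⟩ := exists_posSemidef_factor hEQ hpos hε
  have := hpath (E + ε • Q) J B T hJ hT
  rwa [← hQ] at this

/-- The quintuples with `J = -J*`, `R` in a given set and `E*Q = Q*E ≥ 0`. -/
def sigmaOf (𝓡 : Set (Matrix (Fin ℓ) (Fin ℓ) 𝕜)) (n m : ℕ) : Set (Quintuple 𝕜 ℓ n m) :=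
  {(E, J, R, Q, _B) | J = -Jᴴ ∧ R ∈ 𝓡 ∧ Eᴴ * Q = Qᴴ * E ∧ (Eᴴ * Q).PosSemidef}

/-- The analogue of `relGeneric_sigmaH` for classes with a dissipation matrix. -/
theorem relGeneric_sigmaOf {𝓡 : Set (Matrix (Fin ℓ) (Fin ℓ) 𝕜)}
    (h𝓡 : ∀ R ∈ 𝓡, ∀ s : ℝ, 0 < s → s • R ∈ 𝓡)
    (hJ₁ : J₁ = -J₁ᴴ) (h₁ : pencilDet Θ C E₁ (J₁ * E₁) B₁ ≠ 0)
    {S : Set (Quintuple 𝕜 ℓ n m)}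
    (hS : ∀ E J R Q B, (E, J, R, Q, B) ∈ sigmaOf 𝓡 n m → pencilDet Θ C E ((J - R) * Q) B ≠ 0 →
      (E, J, R, Q, B) ∈ S) : RelGeneric S (sigmaOf 𝓡 n m) := by
  let f : Quintuple 𝕜 ℓ n m → ℝ := fun x =>
    RCLike.normSq (pencilDet Θ C x.1 ((x.2.1 - x.2.2.1) * x.2.2.2.1) x.2.2.2.2)
  have hid : PolyMap (fun x : Quintuple 𝕜 ℓ n m => x) := PolyMap.of_linear LinearMap.id
  have hf : f ∈ polyFun (Quintuple 𝕜 ℓ n m) :=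
    normSq_pencilDet_mem Θ C hid.fst
      ((hid.snd.fst.sub hid.snd.snd.fst).matrix_mul hid.snd.snd.snd.fst) hid.snd.snd.snd.snd
  refine relGeneric_of_polyFun hf (fun ⟨E, J, R, Q, B⟩ hx h => hS E J R Q B hx ?_) ?_
  · simpa [f] using h
  have hpath : ∀ (E J R B) (T : Matrix (Fin ℓ) (Fin ℓ) 𝕜), J = -Jᴴ → R ∈ 𝓡 → T.PosSemidef →
      (E, J, R, T * E, B) ∈ closure {x ∈ sigmaOf 𝓡 n m | f x ≠ 0} := by
    intro E J R B T hJ hR hT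
    -- `R` becomes `(1 - t) • R`, which stays in the cone `𝓡` for `t < 1` even if `0 ∉ 𝓡`.
    let γ : ℝ → Quintuple 𝕜 ℓ n m := fun t => (segmentPath E E₁ t, segmentPath J J₁ t,
      segmentPath R 0 t, segmentPath T 1 t * segmentPath E E₁ t, segmentPath B B₁ t)
    have h0 : γ 0 = (E, J, R, T * E, B) := by simp [γ]
    rw [← h0]
    refine mem_closure_of_polyMap_path (Continuous.continuousAt ?_) ?_ ?_ ?_
    · exact (continuous_segmentPath _ _).prodMk ((continuous_segmentPath _ _).prodMk
        ((continuous_segmentPath _ _).prodMk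
        (((continuous_segmentPath _ _).matrix_mul (continuous_segmentPath _ _)).prodMk
          (continuous_segmentPath _ _))))
    · intro t ht ht'
      refine ⟨segmentPath_skew hJ hJ₁ t, ?_,
        mul_factor_isHermitian (segmentPath_posSemidef hT Matrix.PosSemidef.one ht ht') _⟩
      simpa [segmentPath] using h𝓡 R hR _ (sub_pos.2 ht')
    · exact normSq_pencilDet_mem Θ C (polyMap_segmentPath _ _)
        (((polyMap_segmentPath _ _).sub (polyMap_segmentPath _ _)).matrix_mul
          ((polyMap_segmentPath _ _).matrix_mul (polyMap_segmentPath _ _)))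
        (polyMap_segmentPath _ _)
    · simpa [f, γ] using h₁
  rintro ⟨E, J, R, Q, B⟩ ⟨hJ, hR, hEQ, hpos⟩
  rw [← closure_closure]
  have hlim : Filter.Tendsto (fun ε : ℝ => ((E + ε • Q, J, R, Q, B) : Quintuple 𝕜 ℓ n m))
      (nhdsWithin 0 (Set.Ioi 0)) (nhds (E, J, R, Q, B)) := by
    have : Continuous (fun ε : ℝ => ((E + ε • Q, J, R, Q, B) : Quintuple 𝕜 ℓ n m)) := by fun_prop
    simpa using this.continuousAt.mono_left (nhdsWithin_le_nhds (a := (0 : ℝ)) (s := Set.Ioi 0))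
  refine mem_closure_of_tendsto hlim ?_
  filter_upwards [self_mem_nhdsWithin] with ε hε
  obtain ⟨T, hT, hQ⟩ := exists_posSemidef_factor hEQ hpos hε
  have := hpath (E + ε • Q) J R B T hJ hR hT
  rwa [← hQ] at this

theorem sigmaSdH_eq : SigmaSdH 𝕜 ℓ n m = sigmaOf {R | R = Rᴴ ∧ R.PosSemidef} n m := by
  ext ⟨E, J, R, Q, B⟩
  simp [SigmaSdH, sigmaOf, and_assoc]

theorem sigmaDH_eq : SigmaDH 𝕜 ℓ n m = sigmaOf {R | R = Rᴴ ∧ R.PosDef} n m := by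
  ext ⟨E, J, R, Q, B⟩
  simp [SigmaDH, sigmaOf, and_assoc]

theorem smul_mem_posSemidef {R : Matrix (Fin ℓ) (Fin ℓ) 𝕜} (hR : R = Rᴴ ∧ R.PosSemidef) {s : ℝ}
    (hs : 0 < s) : s • R = (s • R)ᴴ ∧ (s • R).PosSemidef :=
  ⟨(hR.2.smul hs.le).isHermitian.eq.symm, hR.2.smul hs.le⟩

theorem smul_mem_posDef {R : Matrix (Fin ℓ) (Fin ℓ) 𝕜} (hR : R = Rᴴ ∧ R.PosDef) {s : ℝ}
    (hs : 0 < s) : s • R = (s • R)ᴴ ∧ (s • R).PosDef :=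
  ⟨(hR.2.smul hs).isHermitian.eq.symm, hR.2.smul hs⟩

end Density

/-! ### Absolute continuity -/

section AbsolutelyContinuous

theorem _root_.AbsolutelyContinuousOnInterval.lipschitz_comp {X Z : Type*} [PseudoMetricSpace X]
    [PseudoMetricSpace Z] {f : ℝ → X} {a b : ℝ} (hf : AbsolutelyContinuousOnInterval f a b)
    {K : NNReal} {g : X → Z} (hg : LipschitzWith K g) :
    AbsolutelyContinuousOnInterval (fun t => g (f t)) a b := by
  rw [absolutelyContinuousOnInterval_iff] at hf ⊢
  intro ε hε
  -- `K + 1` replaces `K` to avoid division by zero.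
  obtain ⟨δ, hδ, h⟩ := hf (ε / (K + 1)) (by positivity)
  refine ⟨δ, hδ, fun I hI hlt => ?_⟩
  have h1 := h I hI hlt
  calc ∑ i ∈ Finset.range I.1, dist (g (f (I.2 i).1)) (g (f (I.2 i).2))
      ≤ ∑ i ∈ Finset.range I.1, (K + 1 : ℝ) * dist (f (I.2 i).1) (f (I.2 i).2) := by
        gcongr with i
        exact (hg.dist_le_mul _ _).trans (by gcongr; linarith)
    _ = (K + 1 : ℝ) * ∑ i ∈ Finset.range I.1, dist (f (I.2 i).1) (f (I.2 i).2) :=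
        (Finset.mul_sum _ _ _).symm
    _ < (K + 1 : ℝ) * (ε / (K + 1)) := by gcongr
    _ = ε := by field_simp

/-- Precomposition with a map that shrinks half-open intervals. -/
theorem _root_.AbsolutelyContinuousOnInterval.comp_of_uIoc_subset {X : Type*} [PseudoMetricSpace X]
    {f : ℝ → X} {g : ℝ → ℝ} (hf : ∀ a b, AbsolutelyContinuousOnInterval f a b)
    (hg : Continuous g) (hd : ∀ s t, dist (g s) (g t) ≤ dist s t)
    (hsub : ∀ s t, Set.uIoc (g s) (g t) ⊆ Set.uIoc s t) (a b : ℝ) :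
    AbsolutelyContinuousOnInterval (fun t => f (g t)) a b := by
  obtain ⟨lo, hlo⟩ := (isCompact_uIcc (a := a) (b := b)).bddBelow_image hg.continuousOn
  obtain ⟨hi, hhi⟩ := (isCompact_uIcc (a := a) (b := b)).bddAbove_image hg.continuousOn
  have hmem : ∀ t ∈ Set.uIcc a b, g t ∈ Set.uIcc lo hi := fun t ht =>
    Set.Icc_subset_uIcc ⟨hlo ⟨t, ht, rfl⟩, hhi ⟨t, ht, rfl⟩⟩
  have h := hf lo hi
  rw [absolutelyContinuousOnInterval_iff] at h ⊢
  intro ε hε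
  obtain ⟨δ, hδ, h⟩ := h ε hε
  refine ⟨δ, hδ, fun I hI hlt => ?_⟩
  refine h (I.1, fun i => (g (I.2 i).1, g (I.2 i).2)) ⟨fun i hi => ?_, ?_⟩ ?_
  · exact ⟨hmem _ (hI.1 i hi).1, hmem _ (hI.1 i hi).2⟩
  · exact fun i hi j hj hij => (hI.2 hi hj hij).mono (hsub _ _) (hsub _ _)
  · exact (Finset.sum_le_sum fun i _ => hd _ _).trans_lt hlt

/-- The glued function is `f (min t c) + g (max t c) - f c`, and both clamping maps shrink half-open
intervals. -/
theorem _root_.AbsolutelyContinuousOnInterval.glue {F : Type*} [NormedAddCommGroup F]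
    {f g : ℝ → F} (hf : ∀ a b, AbsolutelyContinuousOnInterval f a b)
    (hg : ∀ a b, AbsolutelyContinuousOnInterval g a b) {c : ℝ} (hc : f c = g c) (a b : ℝ) :
    AbsolutelyContinuousOnInterval (fun t => if t < c then f t else g t) a b := by
  have h1 := AbsolutelyContinuousOnInterval.comp_of_uIoc_subset hf
    (g := fun t => min t c) (by fun_prop)
    (fun s t => by
      rw [Real.dist_eq, Real.dist_eq]
      exact abs_min_sub_min_le_max s c t c |>.trans (by simp))
    (fun s t x hx => by
      simp only [Set.mem_uIoc] at hx ⊢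
      grind) a b
  have h2 := AbsolutelyContinuousOnInterval.comp_of_uIoc_subset hg
    (g := fun t => max t c) (by fun_prop)
    (fun s t => by
      rw [Real.dist_eq, Real.dist_eq]
      exact abs_max_sub_max_le_max s c t c |>.trans (by simp))
    (fun s t x hx => by
      simp only [Set.mem_uIoc] at hx ⊢
      grind) a b
  have h3 : AbsolutelyContinuousOnInterval (fun _ : ℝ => f c) a b :=
    (LipschitzWith.const (f c)).lipschitzOnWith.absolutelyContinuousOnInterval
  have := (h1.add h2).sub h3
  convert this using 1
  ext t
  by_cases ht : t < c
  · simp [ht, min_eq_left ht.le, max_eq_right ht.le, hc]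
  · simp [ht, min_eq_right (not_lt.1 ht), max_eq_left (not_lt.1 ht)]

/-- The difference of `f` and a primitive of `g` is absolutely continuous with derivative zero
almost everywhere, hence constant. -/
theorem hasDerivAt_of_ae_of_continuous {F : Type*} [NormedAddCommGroup F] [NormedSpace ℝ F]
    [CompleteSpace F] {f g : ℝ → F} (hf : ∀ a b, AbsolutelyContinuousOnInterval f a b)
    (hg : Continuous g) (h : ∀ᵐ t, HasDerivAt f (g t) t) (t : ℝ) : HasDerivAt f (g t) t := by
  have hI : ∀ t, HasDerivAt (fun s => ∫ v in (0 : ℝ)..s, g v) (g t) t := fun t =>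
    (hg.integral_hasStrictDerivAt 0 t).hasDerivAt
  have hCI : ContDiff ℝ 1 (fun s => ∫ v in (0 : ℝ)..s, g v) := by
    rw [contDiff_one_iff_deriv]
    refine ⟨fun t => (hI t).differentiableAt, ?_⟩
    rwa [show deriv (fun s => ∫ v in (0 : ℝ)..s, g v) = g from funext fun t => (hI t).deriv]
  have hconst : ∀ s, f s - (∫ v in (0 : ℝ)..s, g v) = f 0 := by
    intro s
    have hac : AbsolutelyContinuousOnInterval (f - fun s => ∫ v in (0 : ℝ)..s, g v) 0 s :=
      (hf 0 s).sub hCI.contDiffOn.absolutelyContinuousOnInterval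
    obtain ⟨C, hC⟩ := hac.const_of_ae_hasDerivAt_zero (by
      filter_upwards [h] with t ht _
      simpa using ht.sub (hI t))
    have h1 := hC 0 (by simp)
    have h2 := hC s (by simp)
    simp only [Pi.sub_apply, intervalIntegral.integral_same, sub_zero] at h1 h2
    rw [h2, h1]
  have hfe : f = fun s => f 0 + ∫ v in (0 : ℝ)..s, g v := by
    ext1 s
    rw [← hconst s]
    abel
  rw [hfe]
  exact (hI t).const_add _

end AbsolutelyContinuous

/-! ### Trajectories -/

section Behaviour

variable {𝕜 : Type*} [RCLike 𝕜] {ℓ n m : ℕ}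

/-- A linear map between coordinate spaces as a real continuous linear map. -/
noncomputable def realCLM {F G : Type*} [NormedAddCommGroup F] [NormedSpace ℝ F] [NormedSpace 𝕜 F]
    [FiniteDimensional ℝ F] [NormedAddCommGroup G] [NormedSpace ℝ G] [NormedSpace 𝕜 G]
    [LinearMap.CompatibleSMul F G ℝ 𝕜] (L : F →ₗ[𝕜] G) : F →L[ℝ] G :=
  LinearMap.toContinuousLinearMap (L.restrictScalars ℝ)

@[simp] theorem realCLM_apply {F G : Type*} [NormedAddCommGroup F] [NormedSpace ℝ F]
    [NormedSpace 𝕜 F] [FiniteDimensional ℝ F] [NormedAddCommGroup G] [NormedSpace ℝ G]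
    [NormedSpace 𝕜 G] [LinearMap.CompatibleSMul F G ℝ 𝕜] (L : F →ₗ[𝕜] G) (x : F) :
    realCLM L x = L x := rfl

variable {E A : Matrix (Fin ℓ) (Fin n) 𝕜} {B : Matrix (Fin ℓ) (Fin m) 𝕜}

theorem mem_behaviour_of_hasDerivAt {x v : ℝ → Fin n → 𝕜} {u : ℝ → Fin m → 𝕜}
    (hx : ∀ t, HasDerivAt x (v t) t) (hv : Continuous v) (hu : Continuous u)
    (h : ∀ t, E *ᵥ v t = A *ᵥ x t + B *ᵥ u t) : (x, u) ∈ behaviour E A B := by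
  have hxc : Continuous x := continuous_iff_continuousAt.2 fun t => (hx t).continuousAt
  have hE : ∀ t, HasDerivAt (fun s => E *ᵥ x s) (E *ᵥ v t) t := fun t =>
    (realCLM E.mulVecLin).hasFDerivAt.comp_hasDerivAt t (hx t)
  have hEv : Continuous fun t => E *ᵥ v t := (realCLM E.mulVecLin).continuous.comp hv
  refine ⟨hxc.locallyIntegrable, hu.locallyIntegrable, fun a b => ?_, ?_⟩
  · refine (ContDiff.contDiffOn ?_).absolutelyContinuousOnInterval
    rw [contDiff_one_iff_deriv]
    refine ⟨fun t => (hE t).differentiableAt, ?_⟩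
    rwa [show deriv (fun s => E *ᵥ x s) = fun t => E *ᵥ v t from funext fun t => (hE t).deriv]
  · exact Filter.Eventually.of_forall fun t => h t ▸ hE t

theorem _root_.MeasureTheory.LocallyIntegrable.glue {F : Type*} [NormedAddCommGroup F]
    {f g : ℝ → F} (hf : MeasureTheory.LocallyIntegrable f)
    (hg : MeasureTheory.LocallyIntegrable g) (c : ℝ) :
    MeasureTheory.LocallyIntegrable (fun t => if t < c then f t else g t) := by
  have : (fun t => if t < c then f t else g t) =
      (Set.Iio c).indicator f + (Set.Ici c).indicator g := by
    ext1 t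
    by_cases ht : t < c
    · simp [ht]
    · simp [ht, not_lt.1 ht]
  rw [this]
  exact (hf.indicator measurableSet_Iio).add (hg.indicator measurableSet_Ici)

/-- Two trajectories whose `E x` agree at `c` can be concatenated there. -/
theorem glue_mem_behaviour {w₁ w₂ : (ℝ → Fin n → 𝕜) × (ℝ → Fin m → 𝕜)}
    (h₁ : w₁ ∈ behaviour E A B) (h₂ : w₂ ∈ behaviour E A B) {c : ℝ}
    (hc : E *ᵥ w₁.1 c = E *ᵥ w₂.1 c) :
    ((fun t => if t < c then w₁.1 t else w₂.1 t, fun t => if t < c then w₁.2 t else w₂.2 t) :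
      (ℝ → Fin n → 𝕜) × (ℝ → Fin m → 𝕜)) ∈ behaviour E A B := by
  obtain ⟨hx₁, hu₁, hac₁, hd₁⟩ := h₁
  obtain ⟨hx₂, hu₂, hac₂, hd₂⟩ := h₂
  have hE : (fun t => E *ᵥ (if t < c then w₁.1 t else w₂.1 t)) =
      fun t => if t < c then E *ᵥ w₁.1 t else E *ᵥ w₂.1 t := by
    ext1 t
    split_ifs <;> rfl
  refine ⟨hx₁.glue hx₂ c, hu₁.glue hu₂ c, ?_, ?_⟩
  · simp only [hE]
    exact AbsolutelyContinuousOnInterval.glue hac₁ hac₂ hc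
  · simp only [hE]
    have hne : ∀ᵐ t : ℝ, t ≠ c := by
      rw [MeasureTheory.ae_iff]
      simp
    filter_upwards [hd₁, hd₂, hne] with t h1 h2 h3
    rcases lt_or_gt_of_ne h3 with h | h
    · simp only [h, if_true]
      refine h1.congr_of_eventuallyEq ?_
      filter_upwards [Iio_mem_nhds h] with s hs
      simp [Set.mem_Iio.1 hs]
    · simp only [not_lt.2 h.le, if_false]
      refine h2.congr_of_eventuallyEq ?_
      filter_upwards [Ioi_mem_nhds h] with s hs
      simp [not_lt.2 (Set.mem_Ioi.1 hs).le]

/-- Concatenation only needs `E x` to match, so a trajectory from `E *ᵥ w₁.1 0` to `E *ᵥ w₂.1 T`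
bridges the two. -/
theorem StronglyControllable.behaviourallyControllable (h : StronglyControllable E A B) :
    BehaviourallyControllable E A B := by
  obtain ⟨T, hT, h⟩ := h
  intro w₁ hw₁ w₂ hw₂
  obtain ⟨w, hw, h0, h1⟩ := h (w₁.1 0) (w₂.1 T)
  refine ⟨T, hT, _, glue_mem_behaviour (c := T) (glue_mem_behaviour (c := 0) hw₁ hw h0.symm) hw₂ ?_,
    fun t ht => ?_, fun t ht => ?_⟩
  · simp [not_lt.2 hT.le, h1]
  · simp [ht, ht.trans hT]
  · simp [not_lt.2 (le_of_lt ht)]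

theorem CompletelyControllable.stronglyControllable (h : CompletelyControllable E A B) :
    StronglyControllable E A B := by
  obtain ⟨T, hT, h⟩ := h
  refine ⟨T, hT, fun x₀ x_T => ?_⟩
  obtain ⟨w, hw, h0, h1⟩ := h x₀ x_T
  exact ⟨w, hw, by rw [h0.2], by rw [h1.2]⟩

theorem CompletelyControllable.freelyInitializable (h : CompletelyControllable E A B) :
    FreelyInitializable E A B := by
  obtain ⟨T, hT, h⟩ := h
  intro x₀
  obtain ⟨w, hw, h0, -⟩ := h x₀ 0
  exact ⟨w, hw, h0⟩

theorem FreelyInitializable.impulseControllable (h : FreelyInitializable E A B) :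
    ImpulseControllable E A B := by
  intro x₀
  obtain ⟨w, hw, h0⟩ := h x₀
  exact ⟨w, hw, by rw [h0.2]⟩

/-- The map `(v, u) ↦ E v - B u`. -/
def inputMap (E : Matrix (Fin ℓ) (Fin n) 𝕜) (B : Matrix (Fin ℓ) (Fin m) 𝕜) :
    (Fin n → 𝕜) × (Fin m → 𝕜) →ₗ[𝕜] (Fin ℓ → 𝕜) :=
  E.mulVecLin.coprod (-B.mulVecLin)

@[simp] theorem inputMap_apply (p : (Fin n → 𝕜) × (Fin m → 𝕜)) :
    inputMap E B p = E *ᵥ p.1 - B *ᵥ p.2 := by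
  simp [inputMap, sub_eq_add_neg]

/-- If `[E, -B]` is left invertible, then trajectories satisfy an ordinary differential equation
`x' = F x`, `u = G x` together with the constraint `E F x - B G x = A x`. -/
theorem ode_of_mem_behaviour
    {L : (Fin ℓ → 𝕜) →ₗ[𝕜] (Fin n → 𝕜) × (Fin m → 𝕜)} (hL : ∀ p, L (inputMap E B p) = p)
    {w : (ℝ → Fin n → 𝕜) × (ℝ → Fin m → 𝕜)} (hw : w ∈ behaviour E A B) :
    (∀ t, HasDerivAt w.1 (L (A *ᵥ w.1 t)).1 t) ∧ (∀ᵐ t, w.2 t = (L (A *ᵥ w.1 t)).2) ∧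
      ∀ t, inputMap E B (L (A *ᵥ w.1 t)) = A *ᵥ w.1 t := by
  obtain ⟨-, -, hac, hd⟩ := hw
  let K : (Fin ℓ → 𝕜) →ₗ[𝕜] (Fin n → 𝕜) := LinearMap.fst 𝕜 _ _ ∘ₗ L
  have hK : ∀ v, K (E *ᵥ v) = v := fun v => by
    have := hL (v, 0)
    simp only [inputMap_apply, Matrix.mulVec_zero, sub_zero] at this
    simp [K, this]
  have hx : w.1 = fun t => realCLM K (E *ᵥ w.1 t) := by
    ext1 t
    simp [hK]
  have hxac : ∀ a b, AbsolutelyContinuousOnInterval w.1 a b := fun a b => by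
    rw [hx]
    exact (hac a b).lipschitz_comp (realCLM K).lipschitz
  have hxc : Continuous w.1 := continuous_iff_continuousAt.2 fun t =>
    (hxac (t - 1) (t + 1)).continuousOn.continuousAt (by
      rw [Set.uIcc_of_le (by linarith)]
      exact Icc_mem_nhds (by linarith) (by linarith))
  -- Because `x = K (E x)`, it is differentiable wherever `E x` is. So the derivative `d` of `E x`
  -- satisfies `d = E (K d)`, and `A x = d - B u` lies in the range of `inputMap E B`.
  have hae : ∀ᵐ t, HasDerivAt w.1 (L (A *ᵥ w.1 t)).1 t ∧ w.2 t = (L (A *ᵥ w.1 t)).2 ∧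
      inputMap E B (L (A *ᵥ w.1 t)) = A *ᵥ w.1 t := by
    filter_upwards [hd] with t ht
    set d := A *ᵥ w.1 t + B *ᵥ w.2 t with hddef
    have h1 : HasDerivAt w.1 (K d) t := by
      rw [hx]
      exact (realCLM K).hasFDerivAt.comp_hasDerivAt t ht
    have h2 : HasDerivAt (fun s => E *ᵥ w.1 s) (E *ᵥ K d) t :=
      (realCLM E.mulVecLin).hasFDerivAt.comp_hasDerivAt t h1
    have h3 : E *ᵥ K d = d := h2.unique ht
    have h4 : inputMap E B (K d, w.2 t) = A *ᵥ w.1 t := by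
      rw [inputMap_apply, h3, hddef, add_sub_cancel_right]
    have h5 : L (A *ᵥ w.1 t) = (K d, w.2 t) := by rw [← h4, hL]
    rw [h5]
    exact ⟨h1, rfl, h4⟩
  have hLA : Continuous fun t => L (A *ᵥ w.1 t) :=
    (realCLM (L ∘ₗ A.mulVecLin)).continuous.comp hxc
  refine ⟨hasDerivAt_of_ae_of_continuous hxac hLA.fst (hae.mono fun t h => h.1),
    hae.mono fun t h => h.2.1, fun t => ?_⟩
  -- Both sides are continuous, so equality almost everywhere is equality everywhere.
  refine congrFun ((Continuous.ae_eq_iff_eq MeasureTheory.volume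
    (f := fun t => inputMap E B (L (A *ᵥ w.1 t))) (g := fun t => A *ᵥ w.1 t) ?_ ?_).1
      (hae.mono fun t h => h.2.2)) t
  · exact (realCLM (inputMap E B)).continuous.comp hLA
  · exact (realCLM A.mulVecLin).continuous.comp hxc

end Behaviour

/-! ### Algebraic conditions that decide the controllability concepts -/

section Conditions

variable {𝕜 : Type*} [RCLike 𝕜] {ℓ n m : ℕ}
  {E A : Matrix (Fin ℓ) (Fin n) 𝕜} {B : Matrix (Fin ℓ) (Fin m) 𝕜}

theorem eq_zero_of_linear_ode {F : Type*} [NormedAddCommGroup F] [NormedSpace ℝ F] (L : F →L[ℝ] F)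
    {x : ℝ → F} (hx : ∀ t, HasDerivAt x (L (x t)) t) {t₀ : ℝ} (h0 : x t₀ = 0) : x = fun _ => 0 := by
  refine ODE_solution_unique_univ (v := fun _ => L) (s := fun _ => Set.univ) (t₀ := t₀)
    (fun _ => L.lipschitz.lipschitzOnWith) (fun t => ⟨hx t, trivial⟩) (fun t => ⟨?_, trivial⟩) h0
  simpa using hasDerivAt_const t (0 : F)

theorem exists_linear_ode_solution {F : Type*} [NormedAddCommGroup F] [NormedSpace ℝ F]
    [CompleteSpace F] (L : F →L[ℝ] F) (x₀ : F) :
    ∃ x : ℝ → F, x 0 = x₀ ∧ ∀ t, HasDerivAt x (L (x t)) t := by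
  refine ⟨fun t => NormedSpace.exp (t • L) x₀, by simp, fun t => ?_⟩
  simpa using (hasDerivAt_exp_smul_const' (𝕂 := ℝ) L t).clm_apply (hasDerivAt_const t x₀)

/-- Solving `E v - B u = A x` for `(v, u)` gives a feedback `u` and a linear ODE `x' = v`. -/
theorem exists_trajectory_of_bijective (hb : Function.Bijective (inputMap E B)) (x₀ : Fin n → 𝕜) :
    ∃ w ∈ behaviour E A B, ContinuousAt w.1 0 ∧ w.1 0 = x₀ := by
  let L := (LinearEquiv.ofBijective (inputMap E B) hb).symm
  have hL : ∀ v, inputMap E B (L v) = v := fun v =>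
    LinearEquiv.apply_symm_apply (LinearEquiv.ofBijective (inputMap E B) hb) v
  let F : (Fin n → 𝕜) →L[ℝ] (Fin n → 𝕜) :=
    realCLM (LinearMap.fst 𝕜 _ _ ∘ₗ L.toLinearMap ∘ₗ A.mulVecLin)
  obtain ⟨x, hx0, hx⟩ := exists_linear_ode_solution F x₀
  have hxc : Continuous x := continuous_iff_continuousAt.2 fun t => (hx t).continuousAt
  have hLA : Continuous fun t => L (A *ᵥ x t) :=
    (realCLM (L.toLinearMap ∘ₗ A.mulVecLin)).continuous.comp hxc
  refine ⟨(x, fun t => (L (A *ᵥ x t)).2), ?_, hxc.continuousAt, hx0⟩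
  refine mem_behaviour_of_hasDerivAt hx (F.continuous.comp hxc) hLA.snd fun t => ?_
  have := hL (A *ᵥ x t)
  rw [inputMap_apply, sub_eq_iff_eq_add] at this
  exact this

theorem eq_zero_of_mem_behaviour_of_injective (hi : Function.Injective (inputMap E B))
    {w : (ℝ → Fin n → 𝕜) × (ℝ → Fin m → 𝕜)} (hw : w ∈ behaviour E A B) {t₀ : ℝ}
    (h0 : w.1 t₀ = 0) : w.1 = fun _ => 0 := by
  obtain ⟨L, hL⟩ := LinearMap.exists_leftInverse_of_injective _ (LinearMap.ker_eq_bot.2 hi)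
  have h := (ode_of_mem_behaviour (fun p => LinearMap.congr_fun hL p) hw).1
  exact eq_zero_of_linear_ode (realCLM (LinearMap.fst 𝕜 _ _ ∘ₗ L ∘ₗ A.mulVecLin)) h h0

theorem zero_mem_behaviour : ((fun _ => 0, fun _ => 0) : (ℝ → Fin n → 𝕜) × (ℝ → Fin m → 𝕜)) ∈
    behaviour E A B :=
  mem_behaviour_of_hasDerivAt (v := fun _ => 0) (fun t => hasDerivAt_const t 0) continuous_const
    continuous_const (by simp)

theorem mulVec_injective_of_inputMap (hi : Function.Injective (inputMap E B)) {v v' : Fin n → 𝕜}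
    (h : E *ᵥ v = E *ᵥ v') : v = v' := by
  have := @hi (v, 0) (v', 0) (by simp [h])
  exact congrArg Prod.fst this

theorem freelyInitializable_of_bijective (hb : Function.Bijective (inputMap E B)) :
    FreelyInitializable E A B := exists_trajectory_of_bijective hb

theorem not_stronglyControllable_of_injective (hn : 0 < n)
    (hi : Function.Injective (inputMap E B)) : ¬ StronglyControllable E A B := by
  rintro ⟨T, -, h⟩
  obtain ⟨w, hw, h0, h1⟩ := h 0 (fun _ => 1)
  have h0 := mulVec_injective_of_inputMap hi h0
  have h1 := mulVec_injective_of_inputMap hi h1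
  rw [eq_zero_of_mem_behaviour_of_injective hi hw h0] at h1
  exact zero_ne_one (congrFun h1 ⟨0, hn⟩)

/-- Zero cannot be linked to a nonzero trajectory: a trajectory that vanishes once vanishes forever.
Surjectivity supplies the nonzero one. -/
theorem not_behaviourallyControllable_of_bijective (hn : 0 < n)
    (hb : Function.Bijective (inputMap E B)) : ¬ BehaviourallyControllable E A B := by
  intro h
  obtain ⟨w₂, hw₂, -, h0⟩ := exists_trajectory_of_bijective (A := A) hb (fun _ => 1)
  obtain ⟨T, hT, w, hw, h1, h2⟩ := h _ zero_mem_behaviour _ hw₂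
  have hw0 := eq_zero_of_mem_behaviour_of_injective hb.1 hw (h1 (-1) (by norm_num)).1
  have h3 := (h2 (T + 1) (by simp)).1
  rw [hw0] at h3
  rw [eq_zero_of_mem_behaviour_of_injective hb.1 hw₂ h3.symm] at h0
  exact zero_ne_one (congrFun h0 ⟨0, hn⟩)

/-- The first `n` derivatives of the system equations, as a linear map on the derivatives of
`x` and `u`. -/
def derivArray (n : ℕ) {ℓ m : ℕ} : (Matrix (Fin ℓ) (Fin n) 𝕜 × Matrix (Fin ℓ) (Fin n) 𝕜 ×
    Matrix (Fin ℓ) (Fin m) 𝕜) →ₗ[𝕜]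
    ((Fin (n + 1) → Fin n → 𝕜) × (Fin n → Fin m → 𝕜)) →ₗ[𝕜] (Fin n → Fin ℓ → 𝕜) :=
  LinearMap.mk₂ 𝕜
    (fun p y s => p.1 *ᵥ y.1 s.succ - p.2.1 *ᵥ y.1 s.castSucc - p.2.2 *ᵥ y.2 s)
    (fun p q y => by
      ext1 s
      simp only [Prod.fst_add, Prod.snd_add, Matrix.add_mulVec, Pi.add_apply]
      abel)
    (fun c p y => by
      ext1 s
      simp only [Prod.smul_fst, Prod.smul_snd, Matrix.smul_mulVec, Pi.smul_apply, smul_sub])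
    (fun p y z => by
      ext1 s
      simp only [Prod.fst_add, Prod.snd_add, Matrix.mulVec_add, Pi.add_apply]
      abel)
    (fun c p y => by
      ext1 s
      simp only [Prod.smul_fst, Prod.smul_snd, Matrix.mulVec_smul, Pi.smul_apply, smul_sub])

@[simp] theorem derivArray_apply (y : (Fin (n + 1) → Fin n → 𝕜) × (Fin n → Fin m → 𝕜)) (s : Fin n) :
    derivArray n (E, A, B) y s = E *ᵥ y.1 s.succ - A *ᵥ y.1 s.castSucc - B *ᵥ y.2 s := rfl

/-- A kernel vector placed in the top derivative slots of `x` and `u` is seen only by the last block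
of the array, where it gives `E v - B u`. -/
theorem inputMap_injective_of_derivArray (hn : 0 < n)
    (h : Function.Injective (derivArray n (E, A, B))) : Function.Injective (inputMap E B) := by
  obtain ⟨k, rfl⟩ : ∃ k, n = k + 1 := ⟨n - 1, by omega⟩
  rw [← LinearMap.ker_eq_bot, LinearMap.ker_eq_bot'] at h ⊢
  rintro ⟨v, u⟩ hvu
  have := h (Pi.single (Fin.last (k + 1)) v, Pi.single (Fin.last k) u) (by
    ext1 s
    rw [derivArray_apply]
    dsimp only
    rw [Pi.single_eq_of_ne (Fin.castSucc_lt_last s).ne, Matrix.mulVec_zero, sub_zero]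
    by_cases hs : s = Fin.last k
    · subst hs
      simpa using hvu
    · have : s.succ ≠ Fin.last (k + 1) := by
        rwa [← Fin.succ_last, Ne, Fin.succ_inj]
      rw [Pi.single_eq_of_ne this, Pi.single_eq_of_ne hs]
      simp)
  have h1 := congrFun (congrArg Prod.fst this) (Fin.last (k + 1))
  have h2 := congrFun (congrArg Prod.snd this) (Fin.last k)
  simp only [Pi.single_eq_same] at h1 h2
  simp [h1, h2]

theorem eq_zero_of_derivArray_injective (hn : 0 < n)
    (h : Function.Injective (derivArray n (E, A, B)))
    {w : (ℝ → Fin n → 𝕜) × (ℝ → Fin m → 𝕜)} (hw : w ∈ behaviour E A B) (t : ℝ) : w.1 t = 0 := by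
  obtain ⟨L, hL⟩ := LinearMap.exists_leftInverse_of_injective _
    (LinearMap.ker_eq_bot.2 (inputMap_injective_of_derivArray hn h))
  obtain ⟨hd, -, hc⟩ := ode_of_mem_behaviour (fun p => LinearMap.congr_fun hL p) hw
  let F : (Fin n → 𝕜) →ₗ[𝕜] (Fin n → 𝕜) := LinearMap.fst 𝕜 _ _ ∘ₗ L ∘ₗ A.mulVecLin
  let G : (Fin n → 𝕜) →ₗ[𝕜] (Fin m → 𝕜) := LinearMap.snd 𝕜 _ _ ∘ₗ L ∘ₗ A.mulVecLin
  let M : (Fin n → 𝕜) →ₗ[𝕜] (Fin ℓ → 𝕜) := inputMap E B ∘ₗ L ∘ₗ A.mulVecLin - A.mulVecLin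
  -- Differentiating the constraint `M x = 0` along `x' = F x`. The vectors `F ^ i x` and `G (F ^ i
  -- x)` then form a kernel element of the array, whose zeroth entry is `x t`.
  have hM : ∀ i t, M ((F ^ i) (w.1 t)) = 0 := by
    intro i
    induction i with
    | zero => exact fun t => sub_eq_zero.2 (hc t)
    | succ i ih =>
      intro t
      have h1 : HasDerivAt (fun s => (M ∘ₗ (F ^ i)) (w.1 s)) ((M ∘ₗ (F ^ i)) (F (w.1 t))) t :=
        (realCLM (M ∘ₗ (F ^ i))).hasFDerivAt.comp_hasDerivAt t (hd t)
      have h2 : (fun s => (M ∘ₗ (F ^ i)) (w.1 s)) = fun _ => 0 := funext ih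
      rw [h2] at h1
      rw [pow_succ]
      exact h1.unique (hasDerivAt_const t 0)
  rw [← LinearMap.ker_eq_bot, LinearMap.ker_eq_bot'] at h
  have := h (fun i => (F ^ (i : ℕ)) (w.1 t), fun i => G ((F ^ (i : ℕ)) (w.1 t))) (by
    ext1 s
    have h1 := hM s t
    have h2 : M ((F ^ (s : ℕ)) (w.1 t)) = E *ᵥ F ((F ^ (s : ℕ)) (w.1 t)) -
        B *ᵥ G ((F ^ (s : ℕ)) (w.1 t)) - A *ᵥ ((F ^ (s : ℕ)) (w.1 t)) := by
      simp [M, F, G]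
    rw [h2] at h1
    simp only [derivArray_apply, Fin.val_succ, Fin.val_castSucc, pow_succ', Module.End.mul_apply,
      Pi.zero_apply]
    rw [← h1]
    abel)
  have h1 := congrFun (congrArg Prod.fst this) 0
  simpa using h1

theorem not_impulseControllable_of_derivArray (hn : 0 < n)
    (h : Function.Injective (derivArray n (E, A, B))) : ¬ ImpulseControllable E A B := by
  intro hI
  obtain ⟨w, hw, h0⟩ := hI (fun _ => 1)
  have h1 := mulVec_injective_of_inputMap (inputMap_injective_of_derivArray hn h) h0
  rw [eq_zero_of_derivArray_injective hn h hw] at h1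
  exact zero_ne_one (congrFun h1 ⟨0, hn⟩)

theorem behaviourallyControllable_of_derivArray (hn : 0 < n)
    (h : Function.Injective (derivArray n (E, A, B))) : BehaviourallyControllable E A B := by
  intro w₁ hw₁ w₂ hw₂
  refine ⟨1, one_pos, _, glue_mem_behaviour (c := 0) hw₁ hw₂ ?_, fun t ht => ?_, fun t ht => ?_⟩
  · rw [eq_zero_of_derivArray_injective hn h hw₁, eq_zero_of_derivArray_injective hn h hw₂]
  · simp [ht]
  · have : ¬ t < 0 := by linarith
    simp [this]

/-! ### Steering by polynomial trajectories as a linear surjectivity problem -/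

section Steering

variable {V : Type*} [AddCommGroup V] [Module 𝕜 V] (D : V →ₗ[𝕜] V) (e₀ e₁ : V →ₗ[𝕜] 𝕜)

/-- The operator `(x, u) ↦ E D x - A x - B u` on `V`-valued vectors, linear in `(E, A, B)`; the
other two components vanish. -/
def steerPencil (ℓ n m : ℕ) : (Matrix (Fin ℓ) (Fin n) 𝕜 × Matrix (Fin ℓ) (Fin n) 𝕜 ×
    Matrix (Fin ℓ) (Fin m) 𝕜) →ₗ[𝕜]
    ((Fin n → V) × (Fin m → V)) →ₗ[𝕜] (Fin ℓ → V) × (Fin n → 𝕜) × (Fin n → 𝕜) :=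
  LinearMap.mk₂ 𝕜
    (fun p y => (fun i => ∑ j, p.1 i j • D (y.1 j) - ∑ j, p.2.1 i j • y.1 j -
      ∑ k, p.2.2 i k • y.2 k, 0, 0))
    (fun p q y => by
      ext1
      · ext1 i
        simp only [Prod.fst_add, Prod.snd_add, Matrix.add_apply, Pi.add_apply, add_smul,
          Finset.sum_add_distrib]
        abel
      · simp)
    (fun c p y => by
      ext1
      · ext1 i
        simp only [Prod.smul_fst, Prod.smul_snd, Matrix.smul_apply, Pi.smul_apply, smul_sub,
          Finset.smul_sum, smul_assoc]
      · simp)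
    (fun p y z => by
      ext1
      · ext1 i
        simp only [Prod.fst_add, Prod.snd_add, Pi.add_apply, smul_add, map_add,
          Finset.sum_add_distrib]
        abel
      · simp)
    (fun c p y => by
      ext1
      · ext1 i
        simp only [Prod.smul_fst, Prod.smul_snd, Pi.smul_apply, smul_sub, map_smul,
          Finset.smul_sum, smul_comm c]
      · simp)

/-- The boundary values `(x, u) ↦ (0, e₀ x, e₁ x)`. -/
def steerBoundary (ℓ n m : ℕ) :
    ((Fin n → V) × (Fin m → V)) →ₗ[𝕜] (Fin ℓ → V) × (Fin n → 𝕜) × (Fin n → 𝕜) :=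
  LinearMap.prod 0 (LinearMap.prod (e₀.compLeft (Fin n) ∘ₗ LinearMap.fst 𝕜 _ _)
    (e₁.compLeft (Fin n) ∘ₗ LinearMap.fst 𝕜 _ _))

theorem steer_apply (y : (Fin n → V) × (Fin m → V)) :
    (steerPencil D ℓ n m (E, A, B) + steerBoundary e₀ e₁ ℓ n m) y =
      (fun i => ∑ j, E i j • D (y.1 j) - ∑ j, A i j • y.1 j - ∑ k, B i k • y.2 k,
        fun j => e₀ (y.1 j), fun j => e₁ (y.1 j)) := by
  ext1
  · simp [steerPencil, steerBoundary]
  · ext1 <;> ext1 j <;> simp [steerPencil, steerBoundary]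

end Steering

/-- Differentiation of polynomials of degree less than `N`. -/
noncomputable def derivLT (𝕜 : Type*) [RCLike 𝕜] (N : ℕ) :
    Polynomial.degreeLT 𝕜 N →ₗ[𝕜] Polynomial.degreeLT 𝕜 N :=
  Polynomial.derivative.restrict fun p hp => by
    rw [Polynomial.mem_degreeLT] at hp ⊢
    exact (Polynomial.degree_derivative_le).trans_lt hp

/-- Evaluation of polynomials of degree less than `N`. -/
noncomputable def evalLT {𝕜 : Type*} [RCLike 𝕜] (N : ℕ) (a : 𝕜) :
    Polynomial.degreeLT 𝕜 N →ₗ[𝕜] 𝕜 :=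
  Polynomial.leval a ∘ₗ (Polynomial.degreeLT 𝕜 N).subtype

theorem hasDerivAt_eval_ofReal (p : Polynomial 𝕜) (t : ℝ) :
    HasDerivAt (fun s : ℝ => p.eval (s : 𝕜)) (p.derivative.eval (t : 𝕜)) t := by
  have h1 := p.hasDerivAt (t : 𝕜)
  have h2 : HasDerivAt (fun s : ℝ => (s : 𝕜)) 1 t := by
    simpa using (RCLike.ofRealCLM (K := 𝕜)).hasDerivAt (x := t)
  have h3 := h1.scomp t h2
  rw [one_smul] at h3
  exact h3

theorem completelyControllable_of_steer {N : ℕ}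
    (h : Function.Surjective (steerPencil (derivLT 𝕜 N) ℓ n m (E, A, B) +
      steerBoundary (evalLT N (0 : 𝕜)) (evalLT N (1 : 𝕜)) ℓ n m)) : CompletelyControllable E A B := by
  refine ⟨1, one_pos, fun x₀ x₁ => ?_⟩
  obtain ⟨⟨x, u⟩, hxu⟩ := h (0, x₀, x₁)
  rw [steer_apply, Prod.mk.injEq, Prod.mk.injEq] at hxu
  obtain ⟨heq, h0, h1⟩ := hxu
  have hcont : ∀ p : Polynomial 𝕜, Continuous fun s : ℝ => p.eval (s : 𝕜) := fun p =>
    p.continuous.comp RCLike.continuous_ofReal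
  let X : ℝ → Fin n → 𝕜 := fun t j => (x j : Polynomial 𝕜).eval (t : 𝕜)
  let U : ℝ → Fin m → 𝕜 := fun t j => (u j : Polynomial 𝕜).eval (t : 𝕜)
  have hX : Continuous X := continuous_pi fun j => hcont _
  refine ⟨(X, U), ?_, ⟨hX.continuousAt, ?_⟩, hX.continuousAt, ?_⟩
  · refine mem_behaviour_of_hasDerivAt
      (v := fun t j => (Polynomial.derivative (x j : Polynomial 𝕜)).eval (t : 𝕜))
      (fun t => hasDerivAt_pi.2 fun j => hasDerivAt_eval_ofReal _ t)
      (continuous_pi fun j => hcont _) (continuous_pi fun j => hcont _) fun t => ?_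
    ext1 i
    -- Evaluating the polynomial identity at `t` gives the `i`-th system equation at that time.
    have := congrArg (evalLT N (t : 𝕜)) (congrFun heq i)
    simp only [map_sub, map_sum, map_smul, Pi.zero_apply, map_zero, smul_eq_mul] at this
    rw [sub_sub, sub_eq_zero] at this
    exact this
  · rw [← h0]
    ext1 j
    simp [X, evalLT]
  · rw [← h1]
    ext1 j
    simp [X, evalLT]

end Conditions

/-! ### Rank conditions as determinantal conditions -/

section Conditions

variable {𝕜 : Type*} [RCLike 𝕜] {ℓ n m : ℕ}

/-- A condition on `(E, A, B)` implied by the nonvanishing of a determinant that does not vanish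
at some system `[E₁, J₁ E₁, B₁]` with skew-Hermitian `J₁`. -/
def GenericCondition (P : Matrix (Fin ℓ) (Fin n) 𝕜 → Matrix (Fin ℓ) (Fin n) 𝕜 →
    Matrix (Fin ℓ) (Fin m) 𝕜 → Prop) : Prop :=
  ∃ (k : ℕ) (Θ : (Matrix (Fin ℓ) (Fin n) 𝕜 × Matrix (Fin ℓ) (Fin n) 𝕜 × Matrix (Fin ℓ) (Fin m) 𝕜)
      →ₗ[𝕜] Matrix (Fin k) (Fin k) 𝕜) (C : Matrix (Fin k) (Fin k) 𝕜)
    (E₁ : Matrix (Fin ℓ) (Fin n) 𝕜) (J₁ : Matrix (Fin ℓ) (Fin ℓ) 𝕜)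
    (B₁ : Matrix (Fin ℓ) (Fin m) 𝕜),
    J₁ = -J₁ᴴ ∧ pencilDet Θ C E₁ (J₁ * E₁) B₁ ≠ 0 ∧
      ∀ E A B, pencilDet Θ C E A B ≠ 0 → P E A B

theorem GenericCondition.mono {P P' : Matrix (Fin ℓ) (Fin n) 𝕜 → Matrix (Fin ℓ) (Fin n) 𝕜 →
    Matrix (Fin ℓ) (Fin m) 𝕜 → Prop} (h : GenericCondition P)
    (hPP' : ∀ E A B, P E A B → P' E A B) : GenericCondition P' := by
  obtain ⟨k, Θ, C, E₁, J₁, B₁, hJ, h1, h⟩ := h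
  exact ⟨k, Θ, C, E₁, J₁, B₁, hJ, h1, fun E A B hd => hPP' E A B (h E A B hd)⟩

variable {Y Z : Type*} [AddCommGroup Y] [Module 𝕜 Y] [AddCommGroup Z] [Module 𝕜 Z]
  (Λ : (Matrix (Fin ℓ) (Fin n) 𝕜 × Matrix (Fin ℓ) (Fin n) 𝕜 × Matrix (Fin ℓ) (Fin m) 𝕜) →ₗ[𝕜]
    Y →ₗ[𝕜] Z) (C₀ : Y →ₗ[𝕜] Z)
  {E₁ : Matrix (Fin ℓ) (Fin n) 𝕜} {J₁ : Matrix (Fin ℓ) (Fin ℓ) 𝕜} {B₁ : Matrix (Fin ℓ) (Fin m) 𝕜}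

/-- Composing with a right inverse `S` of the operator at the example gives an endomorphism of `Z`
with determinant `1` there. Wherever this determinant is nonzero the operator is surjective. -/
theorem genericCondition_surjective [FiniteDimensional 𝕜 Z] (hJ : J₁ = -J₁ᴴ)
    (h : Function.Surjective (Λ (E₁, J₁ * E₁, B₁) + C₀)) :
    GenericCondition fun E A B => Function.Surjective (Λ (E, A, B) + C₀) := by
  obtain ⟨S, hS⟩ := LinearMap.exists_rightInverse_of_surjective _ (LinearMap.range_eq_top.2 h)
  let b := Module.finBasis 𝕜 Z
  let Θ := (LinearMap.toMatrix b b).toLinearMap ∘ₗ LinearMap.lcomp 𝕜 Z S ∘ₗ Λ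
  let C := LinearMap.toMatrix b b (C₀ ∘ₗ S)
  have hdet : ∀ E A B, pencilDet Θ C E A B = LinearMap.det ((Λ (E, A, B) + C₀) ∘ₗ S) := by
    intro E A B
    rw [← LinearMap.det_toMatrix b, LinearMap.add_comp, map_add]
    rfl
  refine ⟨_, Θ, C, E₁, J₁, B₁, hJ, ?_, fun E A B hd => ?_⟩
  · rw [hdet, hS]
    simp
  · rw [hdet] at hd
    have := (LinearMap.equivOfDetNeZero _ hd).surjective
    exact Function.Surjective.of_comp (g := S) this

/-- Dual argument, with a left inverse of the operator at the example. -/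
theorem genericCondition_injective [FiniteDimensional 𝕜 Y] (hJ : J₁ = -J₁ᴴ)
    (h : Function.Injective (Λ (E₁, J₁ * E₁, B₁))) :
    GenericCondition fun E A B => Function.Injective (Λ (E, A, B)) := by
  obtain ⟨S, hS⟩ := LinearMap.exists_leftInverse_of_injective _ (LinearMap.ker_eq_bot.2 h)
  let b := Module.finBasis 𝕜 Y
  let Θ := (LinearMap.toMatrix b b).toLinearMap ∘ₗ LinearMap.llcomp 𝕜 Y Z Y S ∘ₗ Λ
  have hdet : ∀ E A B, pencilDet Θ 0 E A B = LinearMap.det (S ∘ₗ Λ (E, A, B)) := by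
    intro E A B
    rw [← LinearMap.det_toMatrix b, pencilDet, add_zero]
    rfl
  refine ⟨_, Θ, 0, E₁, J₁, B₁, hJ, ?_, fun E A B hd => ?_⟩
  · rw [hdet, hS]
    simp
  · rw [hdet] at hd
    have := (LinearMap.equivOfDetNeZero _ hd).injective
    exact Function.Injective.of_comp (f := S) this

end Conditions

/-! ### A tridiagonal example -/

section Tridiagonal

variable {𝕜 : Type*} [RCLike 𝕜] {ℓ n m : ℕ} {V : Type*} [AddCommGroup V] [Module 𝕜 V]

/-- Extension of a finite family by zero. -/
def zeroExt {W : Type*} [Zero W] {k : ℕ} (f : Fin k → W) (i : ℕ) : W :=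
  if h : i < k then f ⟨i, h⟩ else 0

@[simp] theorem zeroExt_val {W : Type*} [Zero W] {k : ℕ} (f : Fin k → W) (i : Fin k) :
    zeroExt f i = f i := by simp [zeroExt]

theorem zeroExt_of_le {W : Type*} [Zero W] {k : ℕ} (f : Fin k → W) {i : ℕ} (h : k ≤ i) :
    zeroExt f i = 0 := by simp [zeroExt, not_lt.2 h]

theorem sum_ite_val_eq {k : ℕ} (f : Fin k → V) (i : ℕ) :
    ∑ j : Fin k, (if (j : ℕ) = i then (1 : 𝕜) else 0) • f j = zeroExt f i := by
  simp only [ite_smul, one_smul, zero_smul]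
  by_cases h : i < k
  · rw [Finset.sum_eq_single ⟨i, h⟩]
    · simp [zeroExt, h]
    · intro b _ hb
      rw [if_neg]
      rintro rfl
      exact hb rfl
    · simp
  · rw [zeroExt_of_le f (not_lt.1 h)]
    refine Finset.sum_eq_zero fun j _ => if_neg ?_
    have := j.2
    omega

variable (𝕜)

/-- The rectangular identity matrix. -/
def rectId (ℓ n : ℕ) : Matrix (Fin ℓ) (Fin n) 𝕜 :=
  Matrix.of fun i j => if (j : ℕ) = i then 1 else 0

/-- The skew-symmetric tridiagonal matrix. -/
def skewTridiag (ℓ : ℕ) : Matrix (Fin ℓ) (Fin ℓ) 𝕜 :=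
  Matrix.of fun i j => (if (j : ℕ) = i + 1 then 1 else 0) - if (i : ℕ) = j + 1 then 1 else 0

theorem skewTridiag_skew (ℓ : ℕ) : skewTridiag 𝕜 ℓ = -(skewTridiag 𝕜 ℓ)ᴴ := by
  ext i j
  simp only [skewTridiag, Matrix.of_apply, Matrix.neg_apply, Matrix.conjTranspose_apply, star_sub,
    apply_ite star, star_one, star_zero]
  ring

variable {𝕜}

theorem sum_rectId (f : Fin n → V) (i : Fin ℓ) :
    ∑ j, rectId 𝕜 ℓ n i j • f j = zeroExt f i :=
  sum_ite_val_eq f i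

theorem sum_skewTridiag (g : ℕ → V) (i : Fin ℓ) :
    ∑ k : Fin ℓ, skewTridiag 𝕜 ℓ i k • g k =
      (if (i : ℕ) + 1 < ℓ then g (i + 1) else 0) - if (i : ℕ) = 0 then 0 else g (i - 1) := by
  simp only [skewTridiag, Matrix.of_apply, sub_smul, Finset.sum_sub_distrib]
  congr 1
  · rw [sum_ite_val_eq (fun k : Fin ℓ => g k)]
    rfl
  · by_cases hi : (i : ℕ) = 0
    · simp [hi]
    · rw [if_neg hi]
      have : ∀ k : Fin ℓ, ((i : ℕ) = k + 1) = ((k : ℕ) = i - 1) := fun k => by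
        simp only [eq_iff_iff]
        omega
      simp only [this]
      rw [sum_ite_val_eq (fun k : Fin ℓ => g k), zeroExt, dif_pos (by omega)]

theorem sum_skewTridiag_mul_rectId (f : Fin n → V) (i : Fin ℓ) :
    ∑ j, (skewTridiag 𝕜 ℓ * rectId 𝕜 ℓ n) i j • f j =
      (if (i : ℕ) + 1 < ℓ then zeroExt f (i + 1) else 0) -
        if (i : ℕ) = 0 then 0 else zeroExt f (i - 1) := by
  rw [← sum_skewTridiag (𝕜 := 𝕜)]
  simp only [Matrix.mul_apply, Finset.sum_smul, mul_smul]
  rw [Finset.sum_comm]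
  refine Finset.sum_congr rfl fun k _ => ?_
  rw [← Finset.smul_sum, sum_rectId]

theorem mulVec_eq_sum_smul (M : Matrix (Fin ℓ) (Fin n) 𝕜) (v : Fin n → 𝕜) (i : Fin ℓ) :
    (M *ᵥ v) i = ∑ j, M i j • v j := rfl

variable (𝕜)

theorem genericCondition_bijective_inputMap (h : ℓ = n + m) :
    GenericCondition fun E (_ : Matrix (Fin ℓ) (Fin n) 𝕜) (B : Matrix (Fin ℓ) (Fin m) 𝕜) =>
      Function.Bijective (inputMap E B) := by
  let Λ : (Matrix (Fin ℓ) (Fin n) 𝕜 × Matrix (Fin ℓ) (Fin n) 𝕜 × Matrix (Fin ℓ) (Fin m) 𝕜) →ₗ[𝕜]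
      ((Fin n → 𝕜) × (Fin m → 𝕜)) →ₗ[𝕜] (Fin ℓ → 𝕜) :=
    LinearMap.mk₂ 𝕜 (fun p y => inputMap p.1 p.2.2 y)
      (fun p q y => by simp [Matrix.add_mulVec]; abel)
      (fun c p y => by simp [Matrix.smul_mulVec, smul_sub])
      (fun p y z => map_add _ _ _) (fun c p y => map_smul _ _ _)
  have hΛ : ∀ E A B, Λ (E, A, B) = inputMap E B := fun E A B => rfl
  have hex : Function.Injective (Λ (rectId 𝕜 ℓ n, skewTridiag 𝕜 ℓ * rectId 𝕜 ℓ n,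
      Matrix.of fun i k => if (k : ℕ) + n = i then 1 else 0)) := by
    rw [← LinearMap.ker_eq_bot, LinearMap.ker_eq_bot', hΛ]
    rintro ⟨v, u⟩ hvu
    rw [inputMap_apply] at hvu
    ext i
    · have := congrFun hvu ⟨i, by omega⟩
      simp only [Pi.sub_apply, mulVec_eq_sum_smul, sum_rectId, zeroExt_val, Matrix.of_apply,
        Pi.zero_apply] at this
      rw [Finset.sum_eq_zero, sub_zero] at this
      · exact this
      · intro k _
        rw [if_neg (by omega), zero_smul]
    · have := congrFun hvu ⟨i + n, by omega⟩
      simp only [Pi.sub_apply, mulVec_eq_sum_smul, sum_rectId, Matrix.of_apply, Nat.add_right_cancel_iff,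
        Pi.zero_apply, sum_ite_val_eq, zeroExt_val] at this
      rw [zeroExt_of_le _ (by simp), zero_sub, neg_eq_zero] at this
      exact this
  refine (genericCondition_injective Λ (skewTridiag_skew 𝕜 ℓ) hex).mono fun E A B hi => ?_
  rw [hΛ] at hi
  refine ⟨hi, (LinearMap.injective_iff_surjective_of_finrank_eq_finrank ?_).1 hi⟩
  simp [h]

/-- In the example the inputs act only on rows beyond the `n`-th (counted from `0`), so rows `0, …,
n` read `x (s + 1) i = x s (i + 1) - x s (i - 1)`, with `x s i = 0` for `i ≥ n`. Row `n` kills entry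
`n - 1`, and repeated use clears `x 0`; the recursion then clears all `x s`, and the remaining rows
clear the inputs. -/
theorem genericCondition_injective_derivArray (h : n + m < ℓ) :
    GenericCondition fun (E A : Matrix (Fin ℓ) (Fin n) 𝕜) (B : Matrix (Fin ℓ) (Fin m) 𝕜) =>
      Function.Injective (derivArray n (E, A, B)) := by
  refine genericCondition_injective (derivArray n) (skewTridiag_skew 𝕜 ℓ) (E₁ := rectId 𝕜 ℓ n)
    (B₁ := Matrix.of fun i k => if (k : ℕ) + (n + 1) = i then 1 else 0) ?_
  rw [← LinearMap.ker_eq_bot, LinearMap.ker_eq_bot']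
  rintro ⟨x, u⟩ hxu
  have heq : ∀ (s : Fin n) (i : Fin ℓ), zeroExt (x s.succ) i -
      ((if (i : ℕ) + 1 < ℓ then zeroExt (x s.castSucc) (i + 1) else 0) -
        if (i : ℕ) = 0 then 0 else zeroExt (x s.castSucc) (i - 1)) -
      ∑ k : Fin m, (if (k : ℕ) + (n + 1) = i then (1 : 𝕜) else 0) • u s k = 0 := by
    intro s i
    have := congrFun (congrFun hxu s) i
    simpa only [derivArray_apply, Pi.sub_apply, mulVec_eq_sum_smul, sum_rectId,
      sum_skewTridiag_mul_rectId, Matrix.of_apply, Pi.zero_apply] using this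
  have hrow : ∀ (s : Fin n) (i : ℕ), i ≤ n → zeroExt (x s.succ) i =
      zeroExt (x s.castSucc) (i + 1) - if i = 0 then 0 else zeroExt (x s.castSucc) (i - 1) := by
    intro s i hi
    have h1 := heq s ⟨i, by omega⟩
    rw [Finset.sum_eq_zero, sub_zero, sub_eq_zero] at h1
    · rw [h1]
      dsimp only
      by_cases hl : i + 1 < ℓ
      · rw [if_pos hl]
      · rw [if_neg hl, zeroExt_of_le (i := i + 1) _ (by omega)]
    · intro k _
      rw [if_neg (by simp; omega), zero_smul]
  let ξ : ℕ → ℕ → 𝕜 := fun s i => if hs : s < n + 1 then zeroExt (x ⟨s, hs⟩) i else 0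
  have hξ : ∀ s i, s < n → i ≤ n → ξ (s + 1) i =
      ξ s (i + 1) - if i = 0 then 0 else ξ s (i - 1) := by
    intro s i hs hi
    have := hrow ⟨s, hs⟩ i hi
    simp only [ξ]
    rw [dif_pos (by omega), dif_pos (by omega), dif_pos (by omega)]
    exact this
  have hξn : ∀ s i, n ≤ i → ξ s i = 0 := by
    intro s i hi
    simp only [ξ]
    split_ifs
    · exact zeroExt_of_le _ hi
    · rfl
  -- Row `i + 1` is solved for `ξ s i`. Each step down in `i` uses one higher derivative; `n`
  -- derivatives suffice to reach `ξ 0 0`.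
  have hvan : ∀ d s i, n ≤ i + d → s + d ≤ n → ξ s i = 0 := by
    intro d
    induction d with
    | zero => exact fun s i hi _ => hξn s i hi
    | succ d ih =>
      intro s i hi hs
      have h1 := hξ s (i + 1)
      by_cases hin : n ≤ i
      · exact hξn s i hin
      · have h2 := h1 (by omega) (by omega)
        rw [ih (s + 1) (i + 1) (by omega) (by omega),
          ih s (i + 2) (by omega) (by omega)] at h2
        simpa using h2.symm
  have h0 : ∀ s i, s ≤ n → ξ s i = 0 := by
    intro s
    induction s with
    | zero => exact fun i _ => hvan n 0 i (by omega) (by omega)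
    | succ s ih =>
      intro i hs
      by_cases hi : i ≤ n
      · rw [hξ s i (by omega) hi, ih _ (by omega), ih _ (by omega)]
        simp
      · exact hξn _ _ (by omega)
  have hx : ∀ s i, zeroExt (x s) i = 0 := by
    intro s i
    have := h0 s i (by omega)
    simp only [ξ] at this
    rwa [dif_pos s.2] at this
  ext s i
  · simpa using hx s i
  · have := heq s ⟨i + (n + 1), by omega⟩
    simp only [hx, Nat.add_right_cancel_iff, sum_ite_val_eq, zeroExt_val] at this
    simpa using this

end Tridiagonal

/-! ### Steering the tridiagonal example by polynomials -/

section Steer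

variable {𝕜 : Type*} [RCLike 𝕜] {V : Type*} [AddCommGroup V] [Module 𝕜 V] (D : V →ₗ[𝕜] V)

/-- The solution of `g (k + 1) = D (g k) + g (k - 1) - φ k` with `g 0 = y`. -/
def chain (φ : ℕ → V) (y : V) : ℕ → V
  | 0 => y
  | 1 => D y - φ 0
  | k + 2 => D (chain φ y (k + 1)) + chain φ y k - φ (k + 1)

theorem chain_succ (φ : ℕ → V) (y : V) (k : ℕ) :
    chain D φ y (k + 1) = D (chain D φ y k) + (if k = 0 then 0 else chain D φ y (k - 1)) - φ k := by
  cases k <;> simp [chain]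

/-- The linear part of `chain`: the Fibonacci polynomials in `D`. -/
def fibOp : ℕ → V →ₗ[𝕜] V
  | 0 => LinearMap.id
  | 1 => D
  | k + 2 => D ∘ₗ fibOp (k + 1) + fibOp k

theorem chain_eq_fibOp_add (φ : ℕ → V) (y : V) :
    ∀ k, chain D φ y k = fibOp D k y + chain D φ 0 k
  | 0 => by simp [chain, fibOp]
  | 1 => by simp [chain, fibOp, sub_eq_add_neg]
  | k + 2 => by
    simp only [chain, fibOp, chain_eq_fibOp_add φ y (k + 1), chain_eq_fibOp_add φ y k,
      LinearMap.add_apply, LinearMap.comp_apply, map_add]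
    abel

/-- Powers of `D` and Fibonacci polynomials in `D` are related triangularly, through `D (fibOp (j +
1)) = fibOp (j + 2) - fibOp j`. -/
theorem apply_pow_fibOp_eq_zero (e : V →ₗ[𝕜] 𝕜) {r : ℕ} {y : V} (h : ∀ k < r, e (fibOp D k y) = 0)
    (k : ℕ) : ∀ j, k + j < r → e ((D ^ k) (fibOp D j y)) = 0 := by
  induction k with
  | zero => exact fun j hj => by simpa using h j (by omega)
  | succ k ih =>
    intro j hj
    rw [pow_succ, Module.End.mul_apply]
    cases j with
    | zero => simpa [fibOp] using ih 1 (by omega)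
    | succ j =>
      have : D (fibOp D (j + 1) y) = fibOp D (j + 2) y - fibOp D j y := by
        simp [fibOp]
      rw [this, map_sub, map_sub, ih _ (by omega), ih _ (by omega), sub_zero]

theorem coe_derivLT_pow {N : ℕ} (k : ℕ) (y : Polynomial.degreeLT 𝕜 N) :
    (((derivLT 𝕜 N) ^ k) y : Polynomial 𝕜) = Polynomial.derivative^[k] (y : Polynomial 𝕜) := by
  induction k with
  | zero => simp
  | succ k ih =>
    rw [pow_succ', Module.End.mul_apply, Function.iterate_succ_apply', ← ih]
    rfl

/-- Such a `p` is divisible by the coprime factors `X ^ r` and `(X - 1) ^ r`, whose product has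
degree `2 * r`. -/
theorem eq_zero_of_hermite_zero {r : ℕ} (hr : 0 < r) {p : Polynomial 𝕜} (hp : p.degree < ↑(2 * r))
    (h0 : ∀ k < r, (Polynomial.derivative^[k] p).eval 0 = 0)
    (h1 : ∀ k < r, (Polynomial.derivative^[k] p).eval 1 = 0) : p = 0 := by
  by_contra hne
  have hd : ∀ a : 𝕜, (∀ k < r, (Polynomial.derivative^[k] p).eval a = 0) →
      (Polynomial.X - Polynomial.C a) ^ r ∣ p := by
    intro a ha
    rw [← Polynomial.le_rootMultiplicity_iff hne]
    have := Polynomial.lt_rootMultiplicity_of_isRoot_iterate_derivative (n := r - 1) (t := a) hne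
      fun k hk => ha k (by omega)
    omega
  have hcop : IsCoprime ((Polynomial.X - Polynomial.C (0 : 𝕜)) ^ r)
      ((Polynomial.X - Polynomial.C (1 : 𝕜)) ^ r) :=
    (Polynomial.isCoprime_X_sub_C_of_isUnit_sub (by simp)).pow
  have hdvd := hcop.mul_dvd (hd 0 h0) (hd 1 h1)
  have hle := Polynomial.degree_le_of_dvd hdvd hne
  rw [Polynomial.degree_mul, Polynomial.degree_pow, Polynomial.degree_pow,
    Polynomial.degree_X_sub_C, Polynomial.degree_X_sub_C] at hle
  have := hle.trans_lt hp
  rw [nsmul_one, ← Nat.cast_add, Nat.cast_lt] at this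
  omega

/-- The boundary values depend affinely on `y`. The linear part is injective by Hermite uniqueness,
and both sides have dimension `2 * r`; this fixes the degree bound. -/
theorem exists_chain_boundary {r : ℕ} (hr : 0 < r) (φ : ℕ → Polynomial.degreeLT 𝕜 (2 * r))
    (α β : ℕ → 𝕜) : ∃ y, ∀ k < r, evalLT (2 * r) (0 : 𝕜) (chain (derivLT 𝕜 (2 * r)) φ y k) = α k ∧
      evalLT (2 * r) (1 : 𝕜) (chain (derivLT 𝕜 (2 * r)) φ y k) = β k := by
  set D := derivLT 𝕜 (2 * r)
  let H : Polynomial.degreeLT 𝕜 (2 * r) →ₗ[𝕜] (Fin r → 𝕜) × (Fin r → 𝕜) :=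
    LinearMap.prod (LinearMap.pi fun k : Fin r => evalLT (2 * r) (0 : 𝕜) ∘ₗ fibOp D k)
      (LinearMap.pi fun k : Fin r => evalLT (2 * r) (1 : 𝕜) ∘ₗ fibOp D k)
  have hinj : Function.Injective H := by
    rw [← LinearMap.ker_eq_bot, LinearMap.ker_eq_bot']
    intro y hy
    have h0 : ∀ k < r, evalLT (2 * r) (0 : 𝕜) (fibOp D k y) = 0 := fun k hk =>
      congrFun (congrArg Prod.fst hy) ⟨k, hk⟩
    have h1 : ∀ k < r, evalLT (2 * r) (1 : 𝕜) (fibOp D k y) = 0 := fun k hk =>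
      congrFun (congrArg Prod.snd hy) ⟨k, hk⟩
    have key : ∀ a : 𝕜, (∀ k < r, evalLT (2 * r) a (fibOp D k y) = 0) → ∀ k < r,
        (Polynomial.derivative^[k] (y : Polynomial 𝕜)).eval a = 0 := by
      intro a ha k hk
      rw [← coe_derivLT_pow]
      exact apply_pow_fibOp_eq_zero D (evalLT (2 * r) a) ha k 0 (by omega)
    exact Subtype.ext
      (eq_zero_of_hermite_zero hr (Polynomial.mem_degreeLT.1 y.2) (key 0 h0) (key 1 h1))
  have hfin : Module.finrank 𝕜 (Polynomial.degreeLT 𝕜 (2 * r)) =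
      Module.finrank 𝕜 ((Fin r → 𝕜) × (Fin r → 𝕜)) := by
    rw [(Polynomial.degreeLTEquiv 𝕜 (2 * r)).finrank_eq]
    simp [two_mul]
  have : FiniteDimensional 𝕜 (Polynomial.degreeLT 𝕜 (2 * r)) :=
    (Polynomial.degreeLTEquiv 𝕜 (2 * r)).symm.finiteDimensional
  obtain ⟨y, hy⟩ := (LinearMap.injective_iff_surjective_of_finrank_eq_finrank hfin).1 hinj
    (fun k => α k - evalLT (2 * r) (0 : 𝕜) (chain D φ 0 k),
      fun k => β k - evalLT (2 * r) (1 : 𝕜) (chain D φ 0 k))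
  refine ⟨y, fun k hk => ?_⟩
  rw [chain_eq_fibOp_add, map_add, map_add]
  have h0 : evalLT (2 * r) (0 : 𝕜) (fibOp D k y) = α k - evalLT (2 * r) (0 : 𝕜) (chain D φ 0 k) :=
    congrFun (congrArg Prod.fst hy) ⟨k, hk⟩
  have h1 : evalLT (2 * r) (1 : 𝕜) (fibOp D k y) = β k - evalLT (2 * r) (1 : 𝕜) (chain D φ 0 k) :=
    congrFun (congrArg Prod.snd hy) ⟨k, hk⟩
  rw [h0, h1]
  simp

variable {ℓ n m : ℕ}

/-- The input matrix steering the tridiagonal chain from its last entry; the remaining inputs act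
on the rows beyond the `n`-th. -/
def chainInput (𝕜 : Type*) [RCLike 𝕜] (ℓ n m : ℕ) : Matrix (Fin ℓ) (Fin m) 𝕜 :=
  Matrix.of fun i k => if (k : ℕ) = 0 then (if (i : ℕ) + 1 = min ℓ n then 1 else 0) else
    if (k : ℕ) + n = i + 1 then 1 else 0

theorem sum_chainInput (hm : 0 < m) (hlt : ℓ < n + m) (U : ℕ → V) (i : Fin ℓ) :
    ∑ k : Fin m, chainInput 𝕜 ℓ n m i k • U k =
      (if (i : ℕ) + 1 = min ℓ n then U 0 else 0) + if n ≤ i then U (i + 1 - n) else 0 := by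
  have hsplit : ∀ k : Fin m, chainInput 𝕜 ℓ n m i k • U k =
      (if (k : ℕ) = 0 then (1 : 𝕜) else 0) • (if (i : ℕ) + 1 = min ℓ n then U 0 else 0) +
      (if (k : ℕ) = i + 1 - n then (1 : 𝕜) else 0) • (if n ≤ i then U k else 0) := by
    intro k
    simp only [chainInput, Matrix.of_apply]
    by_cases hk : (k : ℕ) = 0
    · by_cases hi : n ≤ i
      · simp [hk, hi]
        omega
      · simp [hk, hi]
    · by_cases hi : n ≤ i
      · have : ((k : ℕ) + n = i + 1) = ((k : ℕ) = i + 1 - n) := by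
          simp only [eq_iff_iff]
          omega
        simp [hk, hi, this]
      · have : ¬ (k : ℕ) + n = i + 1 := by omega
        simp [hk, hi, this]
  rw [Finset.sum_congr rfl fun k _ => hsplit k, Finset.sum_add_distrib,
    sum_ite_val_eq (fun _ : Fin m => if (i : ℕ) + 1 = min ℓ n then U 0 else 0),
    sum_ite_val_eq (fun k : Fin m => if n ≤ i then U k else 0)]
  simp only [zeroExt, hm, dif_pos]
  rw [dif_pos (by omega)]

/-- The first `r` rows of the example are the recursion of `chain`, with input `0` in row `r - 1`
standing in for the missing entry `g r`. If `ℓ < n`, the entries from `r` on occur in no equation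
and only have to meet their boundary values. If `ℓ > n`, each row from `n` on has an input of its
own. -/
theorem genericCondition_surjective_steer (𝕜 : Type*) [RCLike 𝕜] (hℓ : 0 < ℓ) (hn : 0 < n)
    (hm : 0 < m) (hlt : ℓ < n + m) : ∃ N,
    GenericCondition fun (E A : Matrix (Fin ℓ) (Fin n) 𝕜) (B : Matrix (Fin ℓ) (Fin m) 𝕜) =>
      Function.Surjective (steerPencil (derivLT 𝕜 N) ℓ n m (E, A, B) +
        steerBoundary (evalLT N (0 : 𝕜)) (evalLT N (1 : 𝕜)) ℓ n m) := by
  set r := min ℓ n with hrdef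
  have hr : 0 < r := by omega
  refine ⟨2 * r, ?_⟩
  have : FiniteDimensional 𝕜 (Polynomial.degreeLT 𝕜 (2 * r)) :=
    (Polynomial.degreeLTEquiv 𝕜 (2 * r)).symm.finiteDimensional
  set D := derivLT 𝕜 (2 * r)
  refine genericCondition_surjective (steerPencil D ℓ n m) _ (skewTridiag_skew 𝕜 ℓ)
    (E₁ := rectId 𝕜 ℓ n) (B₁ := chainInput 𝕜 ℓ n m) ?_
  rintro ⟨f, a, b⟩
  obtain ⟨y, hy⟩ := exists_chain_boundary hr (zeroExt f) (zeroExt a) (zeroExt b)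
  have hfree : ∀ j : Fin n, ∃ z, evalLT (2 * r) (0 : 𝕜) z = a j ∧ evalLT (2 * r) (1 : 𝕜) z = b j :=
    fun j => by
      obtain ⟨z, hz⟩ := exists_chain_boundary hr (zeroExt f) (fun _ => a j) (fun _ => b j)
      exact ⟨z, hz 0 hr⟩
  choose z hz using hfree
  let g := chain D (zeroExt f) y
  let x : Fin n → Polynomial.degreeLT 𝕜 (2 * r) := fun j => if (j : ℕ) < r then g j else z j
  -- For `k ≥ 1` input `k` sits in row `i = n + k - 1`, which reads `x (i - 1) - u k = f i`.
  let U : ℕ → Polynomial.degreeLT 𝕜 (2 * r) := fun k =>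
    if k = 0 then g r else zeroExt x (n + k - 2) - zeroExt f (n + k - 1)
  have hxg : ∀ i, i < r → zeroExt x i = g i := by
    intro i hi
    have hin : i < n := by omega
    simp [zeroExt, hin, x, hi]
  refine ⟨(x, fun k => U k), ?_⟩
  rw [steer_apply]
  refine Prod.ext ?_ (Prod.ext ?_ ?_)
  · ext1 i
    dsimp only
    rw [sum_skewTridiag_mul_rectId, sum_chainInput hm hlt, sum_rectId (fun j => D (x j))]
    have hDx : zeroExt (fun j => D (x j)) i = D (zeroExt x i) := by
      simp only [zeroExt]
      split_ifs <;> simp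
    rw [hDx]
    by_cases hi : (i : ℕ) < r
    · have hni : ¬ n ≤ i := by omega
      have hprev : (if (i : ℕ) = 0 then 0 else zeroExt x (i - 1)) =
          if (i : ℕ) = 0 then 0 else g (i - 1) := by
        split_ifs with h
        · rfl
        · exact hxg _ (by omega)
      have hg := chain_succ D (zeroExt f) y i
      rw [zeroExt_val] at hg
      have hg' : f i = D (g i) + (if (i : ℕ) = 0 then 0 else g (i - 1)) - g (i + 1) := by
        simp only [g, hg]
        abel
      rw [hprev, hxg i hi, if_neg hni, add_zero, hg']
      by_cases hlast : (i : ℕ) + 1 = r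
      · have hlast' : (i : ℕ) + 1 = min ℓ n := by omega
        have hnext : (if (i : ℕ) + 1 < ℓ then zeroExt x (i + 1) else 0) = 0 := by
          split_ifs with h
          · exact zeroExt_of_le _ (by omega)
          · rfl
        rw [hnext, if_pos hlast']
        simp only [U, if_true, ← hlast]
        abel
      · have hlast' : ¬ (i : ℕ) + 1 = min ℓ n := by omega
        have hnext : (i : ℕ) + 1 < ℓ := by omega
        rw [if_neg hlast', if_pos hnext, hxg _ (by omega)]
        abel
    · have hni : n ≤ i := by omega
      have hlast : ¬ (i : ℕ) + 1 = min ℓ n := by omega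
      have hi0 : ¬ (i : ℕ) = 0 := by omega
      have hk0 : ¬ (i : ℕ) + 1 - n = 0 := by omega
      rw [zeroExt_of_le x hni, zeroExt_of_le x (i := i + 1) (by omega), ite_self, if_neg hi0,
        if_neg hlast, if_pos hni]
      simp only [U]
      rw [if_neg hk0, show n + (↑i + 1 - n) - 2 = (i : ℕ) - 1 by omega,
        show n + (↑i + 1 - n) - 1 = (i : ℕ) by omega, zeroExt_val]
      simp
  · ext1 j
    by_cases hj : (j : ℕ) < r
    · simpa [x, hj] using (hy j hj).1
    · simpa [x, hj] using (hz j).1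
  · ext1 j
    by_cases hj : (j : ℕ) < r
    · simpa [x, hj] using (hy j hj).2
    · simpa [x, hj] using (hz j).2

end Steer

/-! ### The generic answer for each concept -/

section Main

/-- The dimensions for which a concept holds generically. -/
def CtrlConcept.Expected (ℓ n m : ℕ) : CtrlConcept → Prop
  | .freelyInitializable => ℓ ≤ n + m
  | .impulseControllable => ℓ ≤ n + m
  | .behaviourallyControllable => ℓ ≠ n + m
  | .completelyControllable => ℓ < n + m
  | .stronglyControllable => ℓ < n + m

variable {𝕜 : Type*} [RCLike 𝕜] {ℓ n m : ℕ}

/-- Generically, exactly the concepts expected from the dimensions hold. -/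
theorem genericCondition_holds_iff_expected (𝕜 : Type*) [RCLike 𝕜] (hℓ : 0 < ℓ) (hn : 0 < n)
    (hm : 0 < m) :
    GenericCondition fun (E A : Matrix (Fin ℓ) (Fin n) 𝕜) (B : Matrix (Fin ℓ) (Fin m) 𝕜) =>
      ∀ c : CtrlConcept, c.Holds E A B ↔ c.Expected ℓ n m := by
  rcases lt_trichotomy ℓ (n + m) with h | h | h
  · obtain ⟨N, hN⟩ := genericCondition_surjective_steer 𝕜 hℓ hn hm h
    refine hN.mono fun E A B hs c => ?_
    have hc := completelyControllable_of_steer hs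
    cases c
    · exact iff_of_true hc.freelyInitializable h.le
    · exact iff_of_true hc.freelyInitializable.impulseControllable h.le
    · exact iff_of_true hc.stronglyControllable.behaviourallyControllable h.ne
    · exact iff_of_true hc h
    · exact iff_of_true hc.stronglyControllable h
  · refine (genericCondition_bijective_inputMap 𝕜 h).mono fun E A B hb c => ?_
    have hf : FreelyInitializable E A B := freelyInitializable_of_bijective hb
    have hs : ¬ StronglyControllable E A B := not_stronglyControllable_of_injective hn hb.1
    cases c
    · exact iff_of_true hf h.le
    · exact iff_of_true hf.impulseControllable h.le
    · exact iff_of_false (not_behaviourallyControllable_of_bijective hn hb) (not_not.2 h)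
    · exact iff_of_false (fun hc => hs hc.stronglyControllable) h.not_lt
    · exact iff_of_false hs h.not_lt
  · refine (genericCondition_injective_derivArray 𝕜 h).mono fun E A B hi c => ?_
    have hI := not_impulseControllable_of_derivArray hn hi
    have hs : ¬ StronglyControllable E A B :=
      not_stronglyControllable_of_injective hn (inputMap_injective_of_derivArray hn hi)
    cases c
    · exact iff_of_false (fun hf => hI hf.impulseControllable) h.not_ge
    · exact iff_of_false hI h.not_ge
    · exact iff_of_true (behaviourallyControllable_of_derivArray hn hi) h.ne'
    · exact iff_of_false (fun hc => hs hc.stronglyControllable) h.not_gt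
    · exact iff_of_false hs h.not_gt

theorem GenericCondition.relGeneric_sigmaH {P : Matrix (Fin ℓ) (Fin n) 𝕜 →
    Matrix (Fin ℓ) (Fin n) 𝕜 → Matrix (Fin ℓ) (Fin m) 𝕜 → Prop} (h : GenericCondition P)
    {S : Set (Quadruple 𝕜 ℓ n m)}
    (hS : ∀ E J Q B, (E, J, Q, B) ∈ SigmaH 𝕜 ℓ n m → P E (J * Q) B → (E, J, Q, B) ∈ S) :
    RelGeneric S (SigmaH 𝕜 ℓ n m) := by
  obtain ⟨k, Θ, C, E₁, J₁, B₁, hJ, h1, h⟩ := h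
  exact PortHamiltonian.relGeneric_sigmaH Θ C hJ h1 fun E J Q B hx hd => hS E J Q B hx (h _ _ _ hd)

theorem GenericCondition.relGeneric_sigmaOf {P : Matrix (Fin ℓ) (Fin n) 𝕜 →
    Matrix (Fin ℓ) (Fin n) 𝕜 → Matrix (Fin ℓ) (Fin m) 𝕜 → Prop} (h : GenericCondition P)
    {𝓡 : Set (Matrix (Fin ℓ) (Fin ℓ) 𝕜)} (h𝓡 : ∀ R ∈ 𝓡, ∀ s : ℝ, 0 < s → s • R ∈ 𝓡)
    {S : Set (Quintuple 𝕜 ℓ n m)}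
    (hS : ∀ E J R Q B, (E, J, R, Q, B) ∈ sigmaOf 𝓡 n m → P E ((J - R) * Q) B →
      (E, J, R, Q, B) ∈ S) : RelGeneric S (sigmaOf 𝓡 n m) := by
  obtain ⟨k, Θ, C, E₁, J₁, B₁, hJ, h1, h⟩ := h
  exact PortHamiltonian.relGeneric_sigmaOf Θ C h𝓡 hJ h1 fun E J R Q B hx hd =>
    hS E J R Q B hx (h _ _ _ hd)

/-- The same determinant serves the set and its complement, since its nonvanishing decides every
concept. -/
theorem relGeneric_ctrlH (hℓ : 0 < ℓ) (hn : 0 < n) (hm : 0 < m) (c : CtrlConcept) :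
    (c.Expected ℓ n m → RelGeneric (ctrlH 𝕜 ℓ n m c) (SigmaH 𝕜 ℓ n m)) ∧
      (¬ c.Expected ℓ n m → RelGeneric (ctrlH 𝕜 ℓ n m c)ᶜ (SigmaH 𝕜 ℓ n m)) := by
  have h := genericCondition_holds_iff_expected (ℓ := ℓ) (n := n) (m := m) 𝕜 hℓ hn hm
  exact ⟨fun hc => h.relGeneric_sigmaH fun E J Q B hx hd => ⟨hx, (hd c).2 hc⟩,
    fun hc => h.relGeneric_sigmaH fun E J Q B _ hd hS => hc ((hd c).1 hS.2)⟩

theorem relGeneric_ctrlSdH (hℓ : 0 < ℓ) (hn : 0 < n) (hm : 0 < m) (c : CtrlConcept) :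
    (c.Expected ℓ n m → RelGeneric (ctrlSdH 𝕜 ℓ n m c) (SigmaSdH 𝕜 ℓ n m)) ∧
      (¬ c.Expected ℓ n m → RelGeneric (ctrlSdH 𝕜 ℓ n m c)ᶜ (SigmaSdH 𝕜 ℓ n m)) := by
  have h := genericCondition_holds_iff_expected (ℓ := ℓ) (n := n) (m := m) 𝕜 hℓ hn hm
  have h𝓡 : ∀ R ∈ {R : Matrix (Fin ℓ) (Fin ℓ) 𝕜 | R = Rᴴ ∧ R.PosSemidef}, ∀ s : ℝ, 0 < s →
      s • R ∈ {R : Matrix (Fin ℓ) (Fin ℓ) 𝕜 | R = Rᴴ ∧ R.PosSemidef} :=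
    fun R hR s hs => smul_mem_posSemidef hR hs
  refine ⟨fun hc => ?_, fun hc => ?_⟩
  · rw [sigmaSdH_eq]
    refine h.relGeneric_sigmaOf h𝓡 fun E J R Q B hx hd => ⟨?_, (hd c).2 hc⟩
    rwa [sigmaSdH_eq]
  · rw [sigmaSdH_eq]
    exact h.relGeneric_sigmaOf h𝓡 fun E J R Q B _ hd hS => hc ((hd c).1 hS.2)

theorem relGeneric_ctrlDH (hℓ : 0 < ℓ) (hn : 0 < n) (hm : 0 < m) (c : CtrlConcept) :
    (c.Expected ℓ n m → RelGeneric (ctrlDH 𝕜 ℓ n m c) (SigmaDH 𝕜 ℓ n m)) ∧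
      (¬ c.Expected ℓ n m → RelGeneric (ctrlDH 𝕜 ℓ n m c)ᶜ (SigmaDH 𝕜 ℓ n m)) := by
  have h := genericCondition_holds_iff_expected (ℓ := ℓ) (n := n) (m := m) 𝕜 hℓ hn hm
  have h𝓡 : ∀ R ∈ {R : Matrix (Fin ℓ) (Fin ℓ) 𝕜 | R = Rᴴ ∧ R.PosDef}, ∀ s : ℝ, 0 < s →
      s • R ∈ {R : Matrix (Fin ℓ) (Fin ℓ) 𝕜 | R = Rᴴ ∧ R.PosDef} :=
    fun R hR s hs => smul_mem_posDef hR hs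
  refine ⟨fun hc => ?_, fun hc => ?_⟩
  · rw [sigmaDH_eq]
    refine h.relGeneric_sigmaOf h𝓡 fun E J R Q B hx hd => ⟨?_, (hd c).2 hc⟩
    rwa [sigmaDH_eq]
  · rw [sigmaDH_eq]
    exact h.relGeneric_sigmaOf h𝓡 fun E J R Q B _ hd hS => hc ((hd c).1 hS.2)

theorem sigmaH_nonempty : (SigmaH 𝕜 ℓ n m).Nonempty :=
  ⟨(0, 0, 0, 0), by simp [SigmaH, Matrix.PosSemidef.zero]⟩

theorem sigmaSdH_nonempty : (SigmaSdH 𝕜 ℓ n m).Nonempty :=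
  ⟨(0, 0, 0, 0, 0), by simp [SigmaSdH, Matrix.PosSemidef.zero]⟩

theorem sigmaDH_nonempty : (SigmaDH 𝕜 ℓ n m).Nonempty :=
  ⟨(0, 0, 1, 0, 0), by simp [SigmaDH, Matrix.PosSemidef.zero, Matrix.PosDef.one]⟩

theorem relGeneric_iff_and_compl {X : Type*} [AddCommGroup X] [Module ℝ X] [TopologicalSpace X]
    [IsTopologicalAddGroup X] [ContinuousSMul ℝ X] [T2Space X] {S : CtrlConcept → Set X} {V : Set X}
    (hV : V.Nonempty)
    (h : ∀ c : CtrlConcept, (c.Expected ℓ n m → RelGeneric (S c) V) ∧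
      (¬ c.Expected ℓ n m → RelGeneric (S c)ᶜ V)) :
    (RelGeneric (S .freelyInitializable) V ↔ ℓ ≤ n + m) ∧
      (RelGeneric (S .impulseControllable) V ↔ ℓ ≤ n + m) ∧
      (RelGeneric (S .behaviourallyControllable) V ↔ ℓ ≠ n + m) ∧
      (RelGeneric (S .completelyControllable) V ↔ ℓ < n + m) ∧
      (RelGeneric (S .stronglyControllable) V ↔ ℓ < n + m) ∧
      ∀ c : CtrlConcept, ¬ RelGeneric (S c) V → RelGeneric (S c)ᶜ V := by
  have key : ∀ c : CtrlConcept, RelGeneric (S c) V ↔ c.Expected ℓ n m := fun c =>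
    ⟨fun hg => by_contra fun hc => hg.not_compl hV ((h c).2 hc), (h c).1⟩
  exact ⟨key _, key _, key _, key _, key _, fun c hc => (h c).2 fun he => hc ((h c).1 he)⟩

end Main

end PortHamiltonian

theorem mainTheorem1 (𝕜 : Type*) [RCLike 𝕜] (ℓ n m : ℕ) (hℓ : 0 < ℓ) (hn : 0 < n) (hm : 0 < m) :
    ((RelGeneric (ctrlH 𝕜 ℓ n m .freelyInitializable) (SigmaH 𝕜 ℓ n m) ↔ ℓ ≤ n + m) ∧
     (RelGeneric (ctrlH 𝕜 ℓ n m .impulseControllable) (SigmaH 𝕜 ℓ n m) ↔ ℓ ≤ n + m) ∧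
     (RelGeneric (ctrlH 𝕜 ℓ n m .behaviourallyControllable) (SigmaH 𝕜 ℓ n m) ↔ ℓ ≠ n + m) ∧
     (RelGeneric (ctrlH 𝕜 ℓ n m .completelyControllable) (SigmaH 𝕜 ℓ n m) ↔ ℓ < n + m) ∧
     (RelGeneric (ctrlH 𝕜 ℓ n m .stronglyControllable) (SigmaH 𝕜 ℓ n m) ↔ ℓ < n + m) ∧
     (∀ c : CtrlConcept, ¬ RelGeneric (ctrlH 𝕜 ℓ n m c) (SigmaH 𝕜 ℓ n m) →
      RelGeneric (ctrlH 𝕜 ℓ n m c)ᶜ (SigmaH 𝕜 ℓ n m))) ∧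
    ((RelGeneric (ctrlSdH 𝕜 ℓ n m .freelyInitializable) (SigmaSdH 𝕜 ℓ n m) ↔ ℓ ≤ n + m) ∧
     (RelGeneric (ctrlSdH 𝕜 ℓ n m .impulseControllable) (SigmaSdH 𝕜 ℓ n m) ↔ ℓ ≤ n + m) ∧
     (RelGeneric (ctrlSdH 𝕜 ℓ n m .behaviourallyControllable) (SigmaSdH 𝕜 ℓ n m) ↔ ℓ ≠ n + m) ∧
     (RelGeneric (ctrlSdH 𝕜 ℓ n m .completelyControllable) (SigmaSdH 𝕜 ℓ n m) ↔ ℓ < n + m) ∧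
     (RelGeneric (ctrlSdH 𝕜 ℓ n m .stronglyControllable) (SigmaSdH 𝕜 ℓ n m) ↔ ℓ < n + m) ∧
     (∀ c : CtrlConcept, ¬ RelGeneric (ctrlSdH 𝕜 ℓ n m c) (SigmaSdH 𝕜 ℓ n m) →
      RelGeneric (ctrlSdH 𝕜 ℓ n m c)ᶜ (SigmaSdH 𝕜 ℓ n m))) ∧
    ((RelGeneric (ctrlDH 𝕜 ℓ n m .freelyInitializable) (SigmaDH 𝕜 ℓ n m) ↔ ℓ ≤ n + m) ∧
     (RelGeneric (ctrlDH 𝕜 ℓ n m .impulseControllable) (SigmaDH 𝕜 ℓ n m) ↔ ℓ ≤ n + m) ∧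
     (RelGeneric (ctrlDH 𝕜 ℓ n m .behaviourallyControllable) (SigmaDH 𝕜 ℓ n m) ↔ ℓ ≠ n + m) ∧
     (RelGeneric (ctrlDH 𝕜 ℓ n m .completelyControllable) (SigmaDH 𝕜 ℓ n m) ↔ ℓ < n + m) ∧
     (RelGeneric (ctrlDH 𝕜 ℓ n m .stronglyControllable) (SigmaDH 𝕜 ℓ n m) ↔ ℓ < n + m) ∧
     (∀ c : CtrlConcept, ¬ RelGeneric (ctrlDH 𝕜 ℓ n m c) (SigmaDH 𝕜 ℓ n m) →
      RelGeneric (ctrlDH 𝕜 ℓ n m c)ᶜ (SigmaDH 𝕜 ℓ n m))) := by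
  exact ⟨relGeneric_iff_and_compl sigmaH_nonempty (relGeneric_ctrlH hℓ hn hm),
    relGeneric_iff_and_compl sigmaSdH_nonempty (relGeneric_ctrlSdH hℓ hn hm),
    relGeneric_iff_and_compl sigmaDH_nonempty (relGeneric_ctrlDH hℓ hn hm)⟩
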